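/- \textbf{Setting.} Let $\mathcal X\subset\mathbb R^d$ with $\mathcal X\subset\overline{\operatorname{int}\mathcal X}$, let $\mathcal Y\subset\mathbb R$, $s\in\mathbb N$, and let $\mathcal H$ be the (real) reproducing kernel Hilbert space of a kernel $\mathcal K\in C^{2s}(\mathcal X\times\mathcal X)$; here $C^{k}$ on a set means continuous, of class $C^k$ in the interior, with derivatives of order $\le k$ extending continuously from the interior to the set, and derivatives at non-interior points are these extensions. For a multi-index $|\boldsymbol\alpha|\le s$ and $x\in\mathcal X$ let $\phi^{(\boldsymbol\alpha)}(x)=D^{\boldsymbol\alpha}_x\mathcal K(x,\cdot)\in\mathcal H$. Let $w_{\boldsymbol\alpha}:\mathcal X\times\mathcal Y\to\mathbb R$ ($|\boldsymbol\alpha|\le s$) be measurable, and for $z=(x,y)$ put $\psi(z)=\sum_{|\boldsymbol\alpha|\le s}w_{\boldsymbol\alpha}(z)\phi^{(\boldsymbol\alpha)}(x)$ and $\mathcal R(h;z)=\sum_{|\boldsymbol\alpha|\le s}w_{\boldsymbol\alpha}(z)D^{\boldsymbol\alpha}h(x)$, $h\in\mathcal H$. Let $\mathbb P$ be a probability distribution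 on $\mathcal X\times\mathcal Y$ with $\mathbb E\|\psi(z)\|_{\mathcal H}^4<\infty$ for $z\sim\mathbb P$, let $z_1,z_2,\ldots\sim\mathbb P$ be such that the $\psi(z_i)$ are independent, and let $\widehat{\mathbb P}=\frac1N\sum_{i=1}^N\delta_{z_i}$. Fix $\lambda>0$. For a distribution $\nu$ of $z$, with mean $\mathbb E_\nu$ and variance $\mathbb V_\nu$, and with $(f\otimes g)u=\langle u,g\rangle f$, define $$h_\nu=\operatorname*{argmin}_{h\in\mathcal H}\Big\{-\mathbb E_\nu[\mathcal R(h;z)]+\tfrac12\mathbb V_\nu[\mathcal R(h;z)]+\tfrac\lambda2\|h\|_{\mathcal H}^2\Big\},\quad \mu_\nu=\mathbb E_\nu[\psi(z)],\quad \Sigma_\nu=\mathbb E_\nu[(\psi(z)-\mu_\nu)\otimes(\psi(z)-\mu_\nu)],$$ $$F_\nu(z)=(\psi(z)-\mu_\nu)-\big((\psi(z)-\mu_\nu)\otimes(\psi(z)-\mu_\nu)-\Sigma_\nu\big)h_\nu,\qquad Q_\nu=\mathbb E_\nu[F_\nu(z)\otimes F_\nu(z)].$$ Fix a multi-index $|\boldsymbol\alpha|\le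 s$ and a grid $\boldsymbol\xi_1,\dots,\boldsymbol\xi_n\in\mathcal X$, and put $$\boldsymbol\theta_\nu=[D^{\boldsymbol\alpha}h_\nu(\boldsymbol\xi_j)]_{j=1}^n,\qquad [\boldsymbol\Omega_\nu]_{k,j}=\langle u_k,Q_\nu u_j\rangle_{\mathcal H},\quad u_j=(\Sigma_\nu+\lambda I)^{-1}\phi^{(\boldsymbol\alpha)}(\boldsymbol\xi_j).$$ Write $\boldsymbol\theta,\boldsymbol\Omega_\lambda$ for $\nu=\mathbb P$ and $\widehat{\boldsymbol\theta},\widehat{\boldsymbol\Omega}_\lambda$ for $\nu=\widehat{\mathbb P}$. Assume that $\boldsymbol\Omega_\lambda$ is positive definite. \textbf{Chi-bar-squared distribution.} For a symmetric positive definite $\boldsymbol V\in\mathbb R^{n\times n}$, a closed convex cone $\mathcal M\subset\mathbb R^n$ and $\boldsymbol Z\sim\mathcal N_n(\boldsymbol 0,\boldsymbol V)$, $\bar\chi^2(\boldsymbol V,\mathcal M)$ is the random variable (and also its law) $$\boldsymbol Z^\top\boldsymbol V^{-1}\boldsymbol Z-\min_{\boldsymbol x\in\mathcal M}(\boldsymbol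 Z-\boldsymbol x)^\top\boldsymbol V^{-1}(\boldsymbol Z-\boldsymbol x).$$ With $\boldsymbol V=\boldsymbol\Omega_\lambda$, the polar cone of $\mathcal M$ is $\mathcal M^\circ=\{\boldsymbol x:\boldsymbol x^\top\boldsymbol\Omega_\lambda^{-1}\boldsymbol y\le0\ \text{for all }\boldsymbol y\in\mathcal M\}$. Let $\chi^2_n$ be the chi-squared law with $n$ degrees of freedom. \textbf{Theorem (Test statistic).} Let $$W_N=\min_{\boldsymbol c\in\mathbb R^n_+}N(\widehat{\boldsymbol\theta}-\boldsymbol c)^\top\widehat{\boldsymbol\Omega}_\lambda^{-1}(\widehat{\boldsymbol\theta}-\boldsymbol c)$$ (with $\widehat{\boldsymbol\Omega}_\lambda^{-1}:=0$ if $\widehat{\boldsymbol\Omega}_\lambda$ is singular); the minimum is attained. Under the least favorable null $\boldsymbol\theta=\boldsymbol 0$, as $N\to\infty$, $$W_N\overset{d}{\longrightarrow}W\sim\bar\chi^2\big(\boldsymbol\Omega_\lambda,(\mathbb R^n_+)^\circ\big).$$ Moreover, if $\boldsymbol Z\sim\mathcal N_n(\boldsymbol 0,\boldsymbol\Omega_\lambda)$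 and both chi-bar-squared variables are formed from this same $\boldsymbol Z$, then $\boldsymbol Z^\top\boldsymbol\Omega_\lambda^{-1}\boldsymbol Z\sim\chi^2_n$ and, almost surely, $$\bar\chi^2\big(\boldsymbol\Omega_\lambda,(\mathbb R^n_+)^\circ\big)=\boldsymbol Z^\top\boldsymbol\Omega_\lambda^{-1}\boldsymbol Z-\bar\chi^2\big(\boldsymbol\Omega_\lambda,\mathbb R^n_+\big).$$ -/

import Mathlib

open MeasureTheory ProbabilityTheory Filter Topology

noncomputable section

namespace KernelShapeTest

/-! ### Multi-indices, partial derivatives and `C^k` functions on a subset of Euclidean space -/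

/-- The multi-indices `α ∈ ℕ^d` with `|α| ≤ s`. -/
def multiIndices (d s : ℕ) : Finset (Fin d → ℕ) :=
  (Finset.Iic (fun _ => s)).filter (fun α => ∑ i, α i ≤ s)

theorem mem_multiIndices {d s : ℕ} {α : Fin d → ℕ} :
    α ∈ multiIndices d s ↔ ∑ i, α i ≤ s := by
  simp only [multiIndices, Finset.mem_filter, Finset.mem_Iic, and_iff_right_iff_imp]
  intro h i
  exact (Finset.single_le_sum (f := α) (fun j _ => Nat.zero_le _) (Finset.mem_univ i)).trans h

/-- The partial derivative `∂f/∂x_i`. -/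
def pderiv {d : ℕ} {F : Type*} [NormedAddCommGroup F] [NormedSpace ℝ F] (i : Fin d)
    (f : EuclideanSpace ℝ (Fin d) → F) : EuclideanSpace ℝ (Fin d) → F :=
  fun x => lineDeriv ℝ f x (EuclideanSpace.single i (1 : ℝ))

/-- The iterated partial derivative `∂^{|α|} f / ∂x_1^{α_1} ⋯ ∂x_d^{α_d}`. -/
def iterPDeriv {d : ℕ} {F : Type*} [NormedAddCommGroup F] [NormedSpace ℝ F] (α : Fin d → ℕ)
    (f : EuclideanSpace ℝ (Fin d) → F) : EuclideanSpace ℝ (Fin d) → F :=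
  (List.finRange d).foldr (fun i g => (pderiv i)^[α i] g) f

/-- The partial derivative `D^α f(x)` of a function `f : X → ℝ` at a point `x` of a set
`X ⊆ closure (interior X)`: at interior points the ordinary one, at the other points of `X` its
continuous extension from the interior. (For the functions considered below `D^α f` is continuous
on the interior, where the extension therefore changes nothing.) -/
def pderivOn {d : ℕ} {X : Set (EuclideanSpace ℝ (Fin d))} (α : Fin d → ℕ) (f : X → ℝ) (x : X) : ℝ :=
  extendFrom (interior X) (iterPDeriv α (Function.extend Subtype.val f 0)) x

/-- `f ∈ C^k(X)`: `f` is continuous on `X`, of class `C^k` in the interior of `X`, and its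
derivatives of order at most `k` extend continuously from the interior to `X`. -/
structure IsCk {E : Type*} [NormedAddCommGroup E] [NormedSpace ℝ E] (k : ℕ) (X : Set E)
    (f : E → ℝ) : Prop where
  continuousOn : ContinuousOn f X
  contDiffOn : ContDiffOn ℝ k f (interior X)
  extends_to : ∀ m ≤ k, ∃ g : E → ContinuousMultilinearMap ℝ (fun _ : Fin m => E) ℝ,
    ContinuousOn g X ∧ Set.EqOn g (iteratedFDeriv ℝ m f) (interior X)

/-! ### The mean-variance problem in a reproducing kernel Hilbert space

Throughout, `H` is the reproducing kernel Hilbert space of a real kernel on `X ⊆ ℝ^d`, data points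
are `z = (x, y) ∈ X × Y`, and `w α : X × Y → ℝ` are the weights. All objects that depend on the
distribution of the data are functions of a measure `ν` on `X × Y`; the population objects are their
values at the data distribution, the sample objects their values at the empirical measure. -/

section RKHS

variable {d : ℕ} {X : Set (EuclideanSpace ℝ (Fin d))} {Y : Set ℝ}
  (H : Type*) [NormedAddCommGroup H] [InnerProductSpace ℝ H] [CompleteSpace H] [RKHS ℝ H X ℝ]

/-- The scalar reproducing kernel `K(x, y)` of `H`. -/
def kern (x y : X) : ℝ := RKHS.kernel H x y (1 : ℝ)

/-- `K ∈ C^k(X × X)`. -/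
def KernelIsCk (k : ℕ) : Prop :=
  IsCk k (X ×ˢ X) (Function.extend
    (fun p : X × X => ((p.1 : EuclideanSpace ℝ (Fin d)), (p.2 : EuclideanSpace ℝ (Fin d))))
    (fun p => kern H p.1 p.2) 0)

/-- `φ^(α)(x) = D^α K(x, ·) ∈ H`, the derivative being taken in the first variable: the element of
`H` which is this function. -/
def featureDeriv (α : Fin d → ℕ) (x : X) : H :=
  Classical.epsilon fun g : H => ∀ y : X, g y = pderivOn α (fun x' => kern H x' y) x

/-- `ψ(z) = ∑_{|α| ≤ s} w_α(z) φ^(α)(x)` for `z = (x, y)`. -/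
def psi (s : ℕ) (w : (Fin d → ℕ) → X × Y → ℝ) (z : X × Y) : H :=
  ∑ α ∈ multiIndices d s, w α z • featureDeriv H α z.1

variable {H}

/-- The target functional `R(h; z) = ∑_{|α| ≤ s} w_α(z) D^α h(x)` for `z = (x, y)`. -/
def target (s : ℕ) (w : (Fin d → ℕ) → X × Y → ℝ) (h : H) (z : X × Y) : ℝ :=
  ∑ α ∈ multiIndices d s, w α z * pderivOn α h z.1

/-- The objective `J(h) = - E[R(h; z)] + V[R(h; z)] / 2 + (lam / 2) ‖h‖²`, `z ∼ ν`. -/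
def objective (s : ℕ) (w : (Fin d → ℕ) → X × Y → ℝ) (lam : ℝ) (ν : Measure (X × Y)) (h : H) : ℝ :=
  -(∫ z, target s w h z ∂ν) + (1 / 2) * variance (fun z => target s w h z) ν
    + (lam / 2) * ‖h‖ ^ 2

variable (H)

/-- The minimizer `argmin_{h ∈ H} J(h)`. -/
def minimizer (s : ℕ) (w : (Fin d → ℕ) → X × Y → ℝ) (lam : ℝ) (ν : Measure (X × Y)) : H :=
  Classical.epsilon fun h : H => ∀ g : H, objective s w lam ν h ≤ objective s w lam ν g

/-- The mean `μ = E[ψ(z)]`. -/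
def meanVec (s : ℕ) (w : (Fin d → ℕ) → X × Y → ℝ) (ν : Measure (X × Y)) : H :=
  ∫ z, psi H s w z ∂ν

/-- The covariance operator `Σ = E[(ψ(z) - μ) ⊗ (ψ(z) - μ)]`, where `(f ⊗ g) u = ⟪u, g⟫ f`. -/
def covOp (s : ℕ) (w : (Fin d → ℕ) → X × Y → ℝ) (ν : Measure (X × Y)) : H →L[ℝ] H :=
  ∫ z, InnerProductSpace.rankOne ℝ (psi H s w z - meanVec H s w ν)
    (psi H s w z - meanVec H s w ν) ∂ν

/-- `(Σ + lam I)⁻¹`. -/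
def resolventOp (s : ℕ) (w : (Fin d → ℕ) → X × Y → ℝ) (lam : ℝ) (ν : Measure (X × Y)) :
    H →L[ℝ] H :=
  Ring.inverse (covOp H s w ν + lam • (1 : H →L[ℝ] H))

/-- `F(z) = (ψ(z) - μ) - ((ψ(z) - μ) ⊗ (ψ(z) - μ) - Σ) h`, where `h` is the minimizer. -/
def fluctuation (s : ℕ) (w : (Fin d → ℕ) → X × Y → ℝ) (lam : ℝ) (ν : Measure (X × Y))
    (z : X × Y) : H :=
  (psi H s w z - meanVec H s w ν) -
    (InnerProductSpace.rankOne ℝ (psi H s w z - meanVec H s w ν) (psi H s w z - meanVec H s w ν)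
      - covOp H s w ν) (minimizer H s w lam ν)

/-- The operator `Q = E[F(z) ⊗ F(z)]`. -/
def fluctuationCov (s : ℕ) (w : (Fin d → ℕ) → X × Y → ℝ) (lam : ℝ) (ν : Measure (X × Y)) :
    H →L[ℝ] H :=
  ∫ z, InnerProductSpace.rankOne ℝ (fluctuation H s w lam ν z) (fluctuation H s w lam ν z) ∂ν

/-- The vector `θ = [D^α h(ξ_j)]_j` of derivatives of the minimizer `h` on the grid `ξ`. -/
def theta (s : ℕ) (w : (Fin d → ℕ) → X × Y → ℝ) (lam : ℝ) (α : Fin d → ℕ) {n : ℕ} (ξ : Fin n → X)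
    (ν : Measure (X × Y)) : EuclideanSpace ℝ (Fin n) :=
  WithLp.toLp 2 fun j => pderivOn α (minimizer H s w lam ν) (ξ j)

/-- The matrix `Ω` with entries `⟪u_k, Q u_j⟫`, where `u_j = (Σ + lam I)⁻¹ φ^(α)(ξ_j)`. -/
def Omega (s : ℕ) (w : (Fin d → ℕ) → X × Y → ℝ) (lam : ℝ) (α : Fin d → ℕ) {n : ℕ} (ξ : Fin n → X)
    (ν : Measure (X × Y)) : Matrix (Fin n) (Fin n) ℝ :=
  Matrix.of fun k j =>
    inner ℝ (resolventOp H s w lam ν (featureDeriv H α (ξ k)))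
      (fluctuationCov H s w lam ν (resolventOp H s w lam ν (featureDeriv H α (ξ j))))

end RKHS

/-- The empirical measure `N⁻¹ ∑_{i < N} δ_{z_i}`. -/
def empirical {Z : Type*} [MeasurableSpace Z] (N : ℕ) (z : ℕ → Z) : Measure Z :=
  (N : ENNReal)⁻¹ • ∑ i ∈ Finset.range N, Measure.dirac (z i)

/-! ### Quadratic forms on cones and the chi-bar-squared distribution -/

/-- The quadratic form `vᵀ A v`. -/
def quad {n : ℕ} (A : Matrix (Fin n) (Fin n) ℝ) (v : EuclideanSpace ℝ (Fin n)) : ℝ :=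
  v.ofLp ⬝ᵥ (A.mulVec v.ofLp)

/-- The nonnegative orthant `ℝ^n_+`. -/
def orthant (n : ℕ) : Set (EuclideanSpace ℝ (Fin n)) := {c | ∀ j, 0 ≤ c j}

/-- The polar cone of `M` for the inner product `⟨x, y⟩ = xᵀ V⁻¹ y`. -/
def polarCone {n : ℕ} (V : Matrix (Fin n) (Fin n) ℝ) (M : Set (EuclideanSpace ℝ (Fin n))) :
    Set (EuclideanSpace ℝ (Fin n)) :=
  {x | ∀ y ∈ M, x.ofLp ⬝ᵥ (V⁻¹.mulVec y.ofLp) ≤ 0}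

/-- `zᵀ V⁻¹ z - min_{x ∈ M} (z - x)ᵀ V⁻¹ (z - x)`, for `V` symmetric positive definite and `M` a
closed convex cone. -/
def chiBarStat {n : ℕ} (V : Matrix (Fin n) (Fin n) ℝ) (M : Set (EuclideanSpace ℝ (Fin n)))
    (z : EuclideanSpace ℝ (Fin n)) : ℝ :=
  quad V⁻¹ z - ⨅ x : M, quad V⁻¹ (z - x)

/-- The chi-bar-squared distribution of `V` and `M`: the law of
`Zᵀ V⁻¹ Z - min_{x ∈ M} (Z - x)ᵀ V⁻¹ (Z - x)` for `Z ∼ N(0, V)`. -/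
def chiBarSq {n : ℕ} (V : Matrix (Fin n) (Fin n) ℝ) (M : Set (EuclideanSpace ℝ (Fin n))) :
    Measure ℝ :=
  (multivariateGaussian 0 V).map (chiBarStat V M)

/-- The chi-squared distribution with `n` degrees of freedom: the law of the sum of the squares of
`n` independent standard normal variables. -/
def chiSq (n : ℕ) : Measure ℝ :=
  (Measure.pi fun _ : Fin n => gaussianReal 0 1).map fun x => ∑ i, x i ^ 2

/-- The test statistic `min_{c ∈ ℝ^n_+} N (θ - c)ᵀ A⁻¹ (θ - c)`. -/
def testStat {n : ℕ} (N : ℕ) (θ : EuclideanSpace ℝ (Fin n)) (A : Matrix (Fin n) (Fin n) ℝ) : ℝ :=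
  ⨅ c : orthant n, (N : ℝ) * quad A⁻¹ (θ - c)

end KernelShapeTest

end

noncomputable section

namespace KernelShapeTest

/-! A kernel of class `C^{2s}` makes every functional `h ↦ D^α h(x)` with `|α| ≤ s` the inner
product with `φ^(α)(x)`, also at boundary points (`KernelIsCk.pderivOn_eq_inner`). Hence `R(h; z) =
⟪ψ(z), h⟫`, the objective is a strictly convex quadratic function, and its minimizer is `(Σ + lam
I)⁻¹ μ` (`minimizer_eq`). The sample quantities are the same expressions in averages of the i.i.d.
vectors `ψ(z_i)`.

With hats for sample quantities and `δ = μ̂ - μ`, the normal equations give the exact identity `ĥ -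
h = (Σ̂ + lam I)⁻¹ (avg F(z_i) + ⟪δ, h⟫ δ)` (`sampleMin_sub_eq`). The last term is quadratic in `δ`,
so it is negligible after multiplication by `√N`, and the resolvent may be replaced by its limit. If
`θ = 0`, then `√N θ̂` is therefore asymptotically the normalized sum of the centred vectors `(⟪u_j,
F(z_i)⟫)_j`, whose covariance is `Ω`. The central limit theorem gives the limit `N(0, Ω)`
(`tendstoInDistribution_sampleTheta`). The fourth moment of `ψ` makes `F` square integrable, and the
strong law gives `Ω̂ → Ω` almost surely (`ae_tendsto_sampleOmega`).

Because the orthant is a cone, `W_N` is the squared distance from `√N θ̂` to the orthant in the form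
`Ω̂⁻¹`. This distance is continuous in the point and is controlled under relative perturbations of
the form, so Slutsky's theorem applies (`tendstoInDistribution_testStat`). Moreau's decomposition
(`chiBarStat_polarCone`) identifies the squared distance to the orthant with the chi-bar-squared
statistic of the polar cone. It also yields the almost sure decomposition, which in fact holds at
every point. -/

/-! ### Differentiability of Hilbert space valued maps through their Gram function -/

section Gram

variable {E H : Type*} [NormedAddCommGroup E] [NormedSpace ℝ E]
  [NormedAddCommGroup H] [InnerProductSpace ℝ H]

/-- A map into a Hilbert space whose Gram function converges along `l ×ˢ l` converges along `l`. -/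
lemma exists_tendsto_of_tendsto_inner [CompleteSpace H] {ι : Type*} {l : Filter ι} [l.NeBot]
    {q : ι → H} {c : ℝ}
    (h : Tendsto (fun p : ι × ι => inner ℝ (q p.1) (q p.2)) (l ×ˢ l) (𝓝 c)) :
    ∃ g, Tendsto q l (𝓝 g) := by
  refine cauchy_map_iff_exists_tendsto.1 (cauchy_map_iff.2 ⟨inferInstance, ?_⟩)
  rw [tendsto_uniformity_iff_dist_tendsto_zero]
  have h1 : Tendsto (fun p : ι × ι => inner ℝ (q p.1) (q p.1)) (l ×ˢ l) (𝓝 c) :=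
    h.comp (tendsto_fst.prodMk tendsto_fst)
  have h2 : Tendsto (fun p : ι × ι => inner ℝ (q p.2) (q p.2)) (l ×ˢ l) (𝓝 c) :=
    h.comp (tendsto_snd.prodMk tendsto_snd)
  -- The squared distance `‖q p.1 - q p.2‖²` expands into Gram entries that all have the limit `c`,
  -- so `q` is Cauchy.
  have h3 := ((h1.sub (h.const_mul 2)).add h2).sqrt
  have e : c - 2 * c + c = 0 := by ring
  rw [e, Real.sqrt_zero] at h3
  refine h3.congr fun p => ?_
  rw [dist_eq_norm, real_inner_self_eq_norm_sq, real_inner_self_eq_norm_sq,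
    ← norm_sub_sq_real, Real.sqrt_sq (norm_nonneg _)]

/-- If the Gram function of `G` is `C²` at `(x, x)`, then `G` has all line derivatives at `x`. -/
lemma lineDifferentiableAt_of_contDiffAt_gram [CompleteSpace H] {G : E → H} {x : E}
    (hL : ContDiffAt ℝ 2 (fun p : E × E => inner ℝ (G p.1) (G p.2)) (x, x)) (v : E) :
    LineDifferentiableAt ℝ G x v := by
  set L : E × E → ℝ := fun p => inner ℝ (G p.1) (G p.2) with hLdef
  set D : E × E → ℝ := fun p => fderiv ℝ L p (v, 0) with hD
  have hD1 : ContDiffAt ℝ 1 D (x, x) :=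
    (hL.fderiv_right (m := 1) (by norm_num)).clm_apply contDiffAt_const
  have hDs := hD1.hasStrictFDerivAt (by norm_num)
  set c : ℝ := fderiv ℝ D (x, x) (0, v) with hc
  have hdiff : ∀ᶠ p in 𝓝 (x, x), DifferentiableAt ℝ L p := by
    have := hL.eventually (by simp)
    filter_upwards [this] with p hp using hp.differentiableAt (by norm_num)
  set q : ℝ → H := fun t => t⁻¹ • (G (x + t • v) - G x) with hq
  -- The Gram function of the difference quotients is a mixed second difference quotient of `L`,
  -- which tends to the mixed derivative `c`.
  have key : Tendsto (fun p : ℝ × ℝ => inner ℝ (q p.1) (q p.2)) (𝓝[≠] 0 ×ˢ 𝓝[≠] 0) (𝓝 c) := by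
    rw [Metric.tendsto_nhds]
    intro ε hε
    -- The final estimate needs `η * ‖v‖ < ε`; adding 1 to the norm covers `v = 0`.
    set η : ℝ := ε / (2 * (‖v‖ + 1)) with hη
    have hηpos : 0 < η := by positivity
    have hlo := hDs.isLittleO.def hηpos
    have c1 : Tendsto (fun a : ℝ × ℝ => ((x + a.1 • v, x + a.2 • v) : E × E)) (𝓝 0) (𝓝 (x, x)) := by
      have : Continuous (fun a : ℝ × ℝ => ((x + a.1 • v, x + a.2 • v) : E × E)) := by fun_prop
      simpa using this.tendsto 0
    have c2 : Tendsto (fun a : ℝ × ℝ => ((x + a.1 • v, x) : E × E)) (𝓝 0) (𝓝 (x, x)) := by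
      have : Continuous (fun a : ℝ × ℝ => ((x + a.1 • v, x) : E × E)) := by fun_prop
      simpa using this.tendsto 0
    have hev := ((c1.prodMk_nhds c2).eventually hlo).and
      ((c1.eventually hdiff).and (c2.eventually hdiff))
    obtain ⟨δ, hδ, hball⟩ := Metric.eventually_nhds_iff_ball.1 hev
    have hnear : ∀ᶠ t in 𝓝[≠] (0 : ℝ), t ∈ Metric.ball (0 : ℝ) δ ∧ t ≠ 0 :=
      (eventually_nhdsWithin_of_eventually_nhds (Metric.ball_mem_nhds 0 hδ)).and
        eventually_mem_nhdsWithin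
    filter_upwards [hnear.prod_mk hnear] with ⟨t, r⟩ ⟨⟨ht, ht0⟩, ⟨hr, hr0⟩⟩
    simp only at ht ht0 hr hr0 ⊢
    -- Mean value inequality in the first increment only. The derivative compares `D` at two points
    -- that both vary with `a`, hence the use of strict differentiability of `D` at `(x, x)`.
    have hmv := Convex.norm_image_sub_le_of_norm_hasDerivWithin_le
      (f := fun a : ℝ => L (x + a • v, x + r • v) - L (x + a • v, x) - a * (r * c))
      (f' := fun a : ℝ => D (x + a • v, x + r • v) - D (x + a • v, x) - r * c)
      (C := η * (|r| * ‖v‖)) (s := Metric.ball (0 : ℝ) δ) (x := 0) (y := t) ?_ ?_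
      (convex_ball _ _) (Metric.mem_ball_self hδ) ht
    · have e : inner ℝ (q t) (q r) - c = (t⁻¹ * r⁻¹) *
          ((fun a : ℝ => L (x + a • v, x + r • v) - L (x + a • v, x) - a * (r * c)) t -
          (fun a : ℝ => L (x + a • v, x + r • v) - L (x + a • v, x) - a * (r * c)) 0) := by
        simp only [hq, hLdef, inner_smul_left, inner_smul_right, inner_sub_left, inner_sub_right,
          zero_smul, add_zero, RCLike.conj_to_real]
        field_simp
        ring
      rw [Real.dist_eq, e, abs_mul, abs_mul, abs_inv, abs_inv]
      rw [Real.norm_eq_abs, sub_zero, Real.norm_eq_abs] at hmv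
      have hta : 0 < |t| := abs_pos.2 ht0
      have hra : 0 < |r| := abs_pos.2 hr0
      calc _ ≤ |t|⁻¹ * |r|⁻¹ * (η * (|r| * ‖v‖) * |t|) := by gcongr
        _ = ε * (‖v‖ / (2 * (‖v‖ + 1))) := by rw [hη]; field_simp
        _ < ε * 1 := by
          gcongr
          rw [div_lt_one (by positivity)]
          linarith [norm_nonneg v]
        _ = ε := mul_one _
    · intro a ha
      obtain ⟨-, h1, h2⟩ := hball (a, r) (by
        rw [← ball_prod_same, Prod.fst_zero, Prod.snd_zero] at *; exact ⟨ha, hr⟩)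
      have d1 : HasDerivAt (fun a : ℝ => ((x + a • v, x + r • v) : E × E)) (v, 0) a := by
        refine HasDerivAt.prodMk ?_ (hasDerivAt_const _ _)
        simpa using ((hasDerivAt_id a).smul_const v).const_add x
      have d2 : HasDerivAt (fun a : ℝ => ((x + a • v, x) : E × E)) (v, 0) a := by
        refine HasDerivAt.prodMk ?_ (hasDerivAt_const _ _)
        simpa using ((hasDerivAt_id a).smul_const v).const_add x
      have := ((h1.hasFDerivAt.comp_hasDerivAt a d1).sub (h2.hasFDerivAt.comp_hasDerivAt a d2)).sub
        ((hasDerivAt_id a).mul_const (r * c))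
      simp only [one_mul] at this
      exact this.hasDerivWithinAt
    · intro a ha
      obtain ⟨h0, -, -⟩ := hball (a, r) (by
        rw [← ball_prod_same, Prod.fst_zero, Prod.snd_zero] at *; exact ⟨ha, hr⟩)
      simp only [Prod.mk_sub_mk, sub_self, add_sub_cancel_left] at h0
      have e1 : ((0 : E), r • v) = r • ((0 : E), v) := by simp
      rw [e1, map_smul, smul_eq_mul, norm_smul, Real.norm_eq_abs r] at h0
      simpa [Prod.norm_def] using h0
  obtain ⟨g, hg⟩ := exists_tendsto_of_tendsto_inner key
  refine HasLineDerivAt.lineDifferentiableAt (f' := g) ?_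
  rw [HasLineDerivAt, hasDerivAt_iff_tendsto_slope_zero]
  simpa [hq] using hg

/-- The Gram function of the line derivative is a mixed second derivative of the Gram function. -/
lemma inner_lineDeriv_lineDeriv {G : E → H} {L : E × E → ℝ} {U : Set E} (hU : IsOpen U)
    (hG : ∀ x ∈ U, ∀ y ∈ U, inner ℝ (G x) (G y) = L (x, y)) {v : E}
    (hd : ∀ x ∈ U, LineDifferentiableAt ℝ G x v) (hL : ∀ x ∈ U, ∀ y ∈ U, ContDiffAt ℝ 2 L (x, y))
    {x y : E} (hx : x ∈ U) (hy : y ∈ U) :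
    inner ℝ (lineDeriv ℝ G x v) (lineDeriv ℝ G y v) =
      fderiv ℝ (fun p => fderiv ℝ L p (v, 0)) (x, y) (0, v) := by
  have hline : ∀ y ∈ U, ∀ᶠ t in 𝓝 (0 : ℝ), y + t • v ∈ U := by
    intro y hy
    have hc : Continuous fun t : ℝ => y + t • v := by fun_prop
    exact hc.continuousAt.eventually_mem (hU.mem_nhds (by simpa using hy))
  -- Proved for all `y` in `U`, because the identity is next differentiated in `y`.
  have h1 : ∀ y ∈ U, inner ℝ (lineDeriv ℝ G x v) (G y) = fderiv ℝ L (x, y) (v, 0) := by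
    intro y hy
    have a1 : HasDerivAt (fun t : ℝ => inner ℝ (G (x + t • v)) (G y))
        (inner ℝ (lineDeriv ℝ G x v) (G y)) 0 := by
      have := HasDerivAt.inner ℝ (hd x hx).hasLineDerivAt (hasDerivAt_const (0 : ℝ) (G y))
      simpa using this
    have a2 : HasDerivAt (fun t : ℝ => L (x + t • v, y)) (fderiv ℝ L (x, y) (v, 0)) 0 := by
      have d1 : HasDerivAt (fun t : ℝ => ((x + t • v, y) : E × E)) (v, 0) 0 := by
        refine HasDerivAt.prodMk ?_ (hasDerivAt_const _ _)
        simpa using ((hasDerivAt_id (0 : ℝ)).smul_const v).const_add x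
      have hf : HasFDerivAt L (fderiv ℝ L (x, y)) (x + (0 : ℝ) • v, y) := by
        simpa using ((hL x hx y hy).differentiableAt (by norm_num)).hasFDerivAt
      exact hf.comp_hasDerivAt 0 d1
    refine a1.unique (a2.congr_of_eventuallyEq ?_)
    filter_upwards [hline x hx] with t ht using hG _ ht _ hy
  have a1 : HasDerivAt (fun t : ℝ => inner ℝ (lineDeriv ℝ G x v) (G (y + t • v)))
      (inner ℝ (lineDeriv ℝ G x v) (lineDeriv ℝ G y v)) 0 := by
    have := HasDerivAt.inner ℝ (hasDerivAt_const (0 : ℝ) (lineDeriv ℝ G x v))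
      (hd y hy).hasLineDerivAt
    simpa using this
  have a2 : HasDerivAt (fun t : ℝ => fderiv ℝ L (x, y + t • v) (v, 0))
      (fderiv ℝ (fun p => fderiv ℝ L p (v, 0)) (x, y) (0, v)) 0 := by
    have d1 : HasDerivAt (fun t : ℝ => ((x, y + t • v) : E × E)) (0, v) 0 := by
      refine HasDerivAt.prodMk (hasDerivAt_const _ _) ?_
      simpa using ((hasDerivAt_id (0 : ℝ)).smul_const v).const_add y
    have hD1 : ContDiffAt ℝ 1 (fun p => fderiv ℝ L p (v, 0)) (x, y) :=
      ((hL x hx y hy).fderiv_right (m := 1) (by norm_num)).clm_apply contDiffAt_const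
    have hf : HasFDerivAt (fun p => fderiv ℝ L p (v, 0))
        (fderiv ℝ (fun p => fderiv ℝ L p (v, 0)) (x, y)) (x, y + (0 : ℝ) • v) := by
      simpa using (hD1.differentiableAt (by norm_num)).hasFDerivAt
    exact hf.comp_hasDerivAt 0 d1
  refine a1.unique (a2.congr_of_eventuallyEq ?_)
  filter_upwards [hline y hy] with t ht using h1 _ ht

/-- The Gram function of `G` on `U` is a derivative of order `2 * j` of `K`, in fixed directions. -/
def IsGramDeriv (K : E × E → ℝ) (U : Set E) (j : ℕ) (G : E → H) : Prop :=
  ∃ m : Fin (2 * j) → E × E, ∀ x ∈ U, ∀ y ∈ U,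
    inner ℝ (G x) (G y) = iteratedFDeriv ℝ (2 * j) K (x, y) m

variable {K : E × E → ℝ} {U : Set E}

/-- One line derivative of `G` costs two derivatives of `K`: since `2 * j + 2 ≤ 2 * s`, the Gram
function still has the `C²` regularity that the next one requires. -/
lemma contDiffAt_iteratedFDeriv_apply {s j : ℕ}
    (hK : ∀ x ∈ U, ∀ y ∈ U, ContDiffAt ℝ (2 * s : ℕ) K (x, y)) (hj : j + 1 ≤ s)
    (m : Fin (2 * j) → E × E) {x y : E} (hx : x ∈ U) (hy : y ∈ U) :
    ContDiffAt ℝ 2 (fun p => iteratedFDeriv ℝ (2 * j) K p m) (x, y) := by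
  have h := (hK x hx y hy).iteratedFDeriv_right (m := 2) (i := 2 * j) (by
    norm_cast
    lia)
  exact (ContinuousMultilinearMap.apply ℝ (fun _ : Fin (2 * j) => E × E) ℝ m).contDiff.contDiffAt.comp
    _ h

lemma IsGramDeriv.lineDifferentiableAt [CompleteSpace H] {s j : ℕ} {G : E → H} (hU : IsOpen U)
    (hK : ∀ x ∈ U, ∀ y ∈ U, ContDiffAt ℝ (2 * s : ℕ) K (x, y)) (hj : j + 1 ≤ s)
    (hG : IsGramDeriv K U j G) {x : E} (hx : x ∈ U) (v : E) : LineDifferentiableAt ℝ G x v := by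
  obtain ⟨m, hm⟩ := hG
  refine lineDifferentiableAt_of_contDiffAt_gram ?_ v
  refine (contDiffAt_iteratedFDeriv_apply hK hj m hx hx).congr_of_eventuallyEq ?_
  filter_upwards [(hU.prod hU).mem_nhds (⟨hx, hx⟩ : (x, x) ∈ U ×ˢ U)] with p hp
    using hm _ hp.1 _ hp.2

lemma IsGramDeriv.lineDeriv [CompleteSpace H] {s j : ℕ} {G : E → H} (hU : IsOpen U)
    (hK : ∀ x ∈ U, ∀ y ∈ U, ContDiffAt ℝ (2 * s : ℕ) K (x, y)) (hj : j + 1 ≤ s)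
    (hG : IsGramDeriv K U j G) (v : E) : IsGramDeriv K U (j + 1) (fun x => lineDeriv ℝ G x v) := by
  have hd : ∀ x ∈ U, LineDifferentiableAt ℝ G x v :=
    fun x hx => hG.lineDifferentiableAt hU hK hj hx v
  obtain ⟨m, hm⟩ := hG
  -- `Fin.cons` prepends the latest direction: `(v, 0)` differentiates the first argument of the
  -- Gram function, then `(0, v)` the second.
  refine ⟨(Fin.cons (0, v) (Fin.cons (v, 0) m : Fin (2 * j + 1) → E × E) :
    Fin (2 * j + 1 + 1) → E × E), fun x hx y hy => ?_⟩
  rw [inner_lineDeriv_lineDeriv hU hm hd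
    (fun x hx y hy => contDiffAt_iteratedFDeriv_apply hK hj m hx hy) hx hy]
  have hdiff : ∀ (i : ℕ), i < 2 * s → ∀ x ∈ U, ∀ y ∈ U,
      DifferentiableAt ℝ (iteratedFDeriv ℝ i K) (x, y) := fun i hi x hx y hy =>
    (hK x hx y hy).differentiableAt_iteratedFDeriv (by exact_mod_cast hi)
  have happ : ∀ (i : ℕ) (m : Fin i → E × E) (u : E × E), i < 2 * s → ∀ x ∈ U, ∀ y ∈ U,
      fderiv ℝ (fun p => iteratedFDeriv ℝ i K p m) (x, y) u =
        iteratedFDeriv ℝ (i + 1) K (x, y) (Fin.cons u m : Fin (i + 1) → E × E) := by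
    intro i m u hi x hx y hy
    rw [iteratedFDeriv_succ_apply_left, Fin.cons_zero, Fin.tail_cons]
    have := ((ContinuousMultilinearMap.apply ℝ (fun _ : Fin i => E × E) ℝ m).hasFDerivAt.comp
      (x, y) (hdiff i hi x hx y hy).hasFDerivAt).fderiv
    exact congrArg (fun T => T u) this
  have heq : (fun p => fderiv ℝ (fun p => iteratedFDeriv ℝ (2 * j) K p m) p (v, 0)) =ᶠ[𝓝 (x, y)]
      fun p => iteratedFDeriv ℝ (2 * j + 1) K p (Fin.cons (v, 0) m : Fin (2 * j + 1) → E × E) := by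
    filter_upwards [(hU.prod hU).mem_nhds (⟨hx, hy⟩ : (x, y) ∈ U ×ˢ U)] with p hp
      using happ _ _ _ (by lia) _ hp.1 _ hp.2
  rw [heq.fderiv_eq, happ _ _ _ (by lia) _ hx _ hy]
  rfl

end Gram

/-! ### Derivatives in a reproducing kernel Hilbert space -/

section IteratedGram

variable {d : ℕ} {H : Type*} [NormedAddCommGroup H] [InnerProductSpace ℝ H] [CompleteSpace H]
  {K : EuclideanSpace ℝ (Fin d) × EuclideanSpace ℝ (Fin d) → ℝ}
  {U : Set (EuclideanSpace ℝ (Fin d))} {s : ℕ}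

/-- Joint induction step for a map `G` into `H` and a scalar function `x ↦ ⟪G x, k⟫`. -/
lemma IsGramDeriv.pderiv {j : ℕ} {G : EuclideanSpace ℝ (Fin d) → H}
    {f : EuclideanSpace ℝ (Fin d) → ℝ} {k : H} (hU : IsOpen U)
    (hK : ∀ x ∈ U, ∀ y ∈ U, ContDiffAt ℝ (2 * s : ℕ) K (x, y)) (hj : j + 1 ≤ s)
    (hG : IsGramDeriv K U j G ∧ ∀ x ∈ U, f x = inner ℝ (G x) k) (i : Fin d) :
    IsGramDeriv K U (j + 1) (pderiv i G) ∧ ∀ x ∈ U, pderiv i f x = inner ℝ (pderiv i G x) k := by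
  refine ⟨hG.1.lineDeriv hU hK hj _, fun x hx => ?_⟩
  have h1 := (hG.1.lineDifferentiableAt hU hK hj hx (EuclideanSpace.single i (1 : ℝ))).hasLineDerivAt
  have h2 := HasDerivAt.inner ℝ h1 (hasDerivAt_const (0 : ℝ) k)
  simp only [zero_smul, add_zero, inner_zero_right, zero_add] at h2
  have h3 : HasLineDerivAt ℝ (fun y => inner ℝ (G y) k)
      (inner ℝ (_root_.lineDeriv ℝ G x (EuclideanSpace.single i (1 : ℝ))) k) x
      (EuclideanSpace.single i (1 : ℝ)) := h2
  refine (h3.congr_of_eventuallyEq ?_).lineDeriv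
  filter_upwards [hU.mem_nhds hx] with y hy using hG.2 y hy

lemma IsGramDeriv.pderiv_iterate {j : ℕ} {G : EuclideanSpace ℝ (Fin d) → H}
    {f : EuclideanSpace ℝ (Fin d) → ℝ} {k : H} (hU : IsOpen U)
    (hK : ∀ x ∈ U, ∀ y ∈ U, ContDiffAt ℝ (2 * s : ℕ) K (x, y)) (i : Fin d) (a : ℕ) (hj : j + a ≤ s)
    (hG : IsGramDeriv K U j G ∧ ∀ x ∈ U, f x = inner ℝ (G x) k) :
    IsGramDeriv K U (j + a) ((KernelShapeTest.pderiv i)^[a] G) ∧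
      ∀ x ∈ U, (KernelShapeTest.pderiv i)^[a] f x =
        inner ℝ ((KernelShapeTest.pderiv i)^[a] G x) k := by
  induction a with
  | zero => simpa using hG
  | succ a ih =>
    rw [Function.iterate_succ_apply', Function.iterate_succ_apply', ← add_assoc]
    exact IsGramDeriv.pderiv hU hK (by lia) (ih (by lia)) i

lemma IsGramDeriv.iterPDeriv {G : EuclideanSpace ℝ (Fin d) → H}
    {f : EuclideanSpace ℝ (Fin d) → ℝ} {k : H} (hU : IsOpen U)
    (hK : ∀ x ∈ U, ∀ y ∈ U, ContDiffAt ℝ (2 * s : ℕ) K (x, y)) {α : Fin d → ℕ}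
    (hα : ∑ i, α i ≤ s) (hG : IsGramDeriv K U 0 G ∧ ∀ x ∈ U, f x = inner ℝ (G x) k) :
    IsGramDeriv K U (∑ i, α i) (iterPDeriv α G) ∧
      ∀ x ∈ U, iterPDeriv α f x = inner ℝ (iterPDeriv α G x) k := by
  -- `iterPDeriv` folds over `List.finRange d`; the induction needs arbitrary lists, with `(l.map
  -- α).sum` counting the order used so far.
  have main : ∀ l : List (Fin d), (l.map α).sum ≤ s →
      IsGramDeriv K U (l.map α).sum
        (l.foldr (fun i g => (KernelShapeTest.pderiv i)^[α i] g) G) ∧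
      ∀ x ∈ U, l.foldr (fun i g => (KernelShapeTest.pderiv i)^[α i] g) f x =
        inner ℝ (l.foldr (fun i g => (KernelShapeTest.pderiv i)^[α i] g) G x) k := by
    intro l
    induction l with
    | nil => intro _; simpa using hG
    | cons i l ih =>
      intro h
      simp only [List.map_cons, List.sum_cons, List.foldr_cons] at h ⊢
      rw [add_comm (α i)]
      exact IsGramDeriv.pderiv_iterate hU hK i (α i) (by lia) (ih (by lia))
  have e : ((List.finRange d).map α).sum = ∑ i, α i := by
    rw [← List.ofFn_eq_map, List.sum_ofFn]
  rw [← e] at hα ⊢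
  exact main _ hα

end IteratedGram

/-! ### The derivative reproducing property, up to the boundary of `X`. -/

section RKHSDeriv

variable {d : ℕ} {X : Set (EuclideanSpace ℝ (Fin d))}
  (H : Type*) [NormedAddCommGroup H] [InnerProductSpace ℝ H] [CompleteSpace H] [RKHS ℝ H X ℝ]

/-- The canonical feature map `x ↦ K(x, ·)`, extended by zero. -/
def featureExt : EuclideanSpace ℝ (Fin d) → H :=
  Function.extend Subtype.val (fun x : X => RKHS.kerFun H x (1 : ℝ)) 0

lemma featureExt_coe (x : X) : featureExt H (x : EuclideanSpace ℝ (Fin d)) =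
    RKHS.kerFun H x (1 : ℝ) :=
  Subtype.val_injective.extend_apply _ _ x

lemma kern_eq_inner (x y : X) :
    kern H x y = inner ℝ (RKHS.kerFun H x (1 : ℝ)) (RKHS.kerFun H y (1 : ℝ)) := by
  rw [kern, ← RKHS.kerFun_apply, RKHS.kerFun_inner]
  simp

/-- Both extensions vanish off `X`, so the identity holds on the whole space and can be
differentiated there. -/
lemma extend_eq_inner (h : H) (x : EuclideanSpace ℝ (Fin d)) :
    Function.extend (Subtype.val : X → EuclideanSpace ℝ (Fin d)) h 0 x =
      inner ℝ (featureExt H x) h := by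
  by_cases hx : ∃ a : X, (a : EuclideanSpace ℝ (Fin d)) = x
  · obtain ⟨a, rfl⟩ := hx
    rw [Subtype.val_injective.extend_apply, featureExt_coe]
    simp
  · rw [Function.extend_apply' _ _ _ hx, featureExt, Function.extend_apply' _ _ _ hx]
    simp

/-- The kernel, extended by zero to all pairs of points. -/
def kernExt (p : EuclideanSpace ℝ (Fin d) × EuclideanSpace ℝ (Fin d)) : ℝ :=
  Function.extend
    (fun p : X × X => ((p.1 : EuclideanSpace ℝ (Fin d)), (p.2 : EuclideanSpace ℝ (Fin d))))
    (fun p => kern H p.1 p.2) 0 p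

lemma kernExt_eq_inner {x y : EuclideanSpace ℝ (Fin d)} (hx : x ∈ X) (hy : y ∈ X) :
    kernExt H (x, y) = inner ℝ (featureExt H x) (featureExt H y) := by
  have hinj : Function.Injective (fun p : X × X =>
      ((p.1 : EuclideanSpace ℝ (Fin d)), (p.2 : EuclideanSpace ℝ (Fin d)))) := by
    rintro ⟨a, b⟩ ⟨a', b'⟩ h
    simpa [Subtype.ext_iff] using h
  have := hinj.extend_apply (fun p => kern H p.1 p.2) 0 (⟨x, hx⟩, ⟨y, hy⟩)
  rw [kernExt, this, kern_eq_inner, ← featureExt_coe, ← featureExt_coe]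

variable {H} {s : ℕ}

lemma KernelIsCk.contDiffAt (hK : KernelIsCk H (2 * s)) {x y : EuclideanSpace ℝ (Fin d)}
    (hx : x ∈ interior X) (hy : y ∈ interior X) : ContDiffAt ℝ (2 * s : ℕ) (kernExt H) (x, y) := by
  have hmem : (x, y) ∈ interior (X ×ˢ X) := by rw [interior_prod_eq]; exact ⟨hx, hy⟩
  exact hK.contDiffOn.contDiffAt (isOpen_interior.mem_nhds hmem)

/-- Inside `X`, partial derivatives of the feature map exist in `H` and represent the partial
derivatives of the functions in `H`. -/
lemma KernelIsCk.isGramDeriv (hK : KernelIsCk H (2 * s)) {α : Fin d → ℕ} (hα : ∑ i, α i ≤ s)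
    (h : H) :
    IsGramDeriv (kernExt H) (interior X) (∑ i, α i) (iterPDeriv α (featureExt H)) ∧
      ∀ x ∈ interior X,
        iterPDeriv α (Function.extend (Subtype.val : X → EuclideanSpace ℝ (Fin d)) h 0) x =
          inner ℝ (iterPDeriv α (featureExt H) x) h := by
  refine IsGramDeriv.iterPDeriv isOpen_interior (fun x hx y hy => hK.contDiffAt hx hy) hα
    ⟨⟨Fin.elim0, fun x hx y hy => ?_⟩, fun x _ => extend_eq_inner H h x⟩
  rw [← kernExt_eq_inner H (interior_subset hx) (interior_subset hy)]
  exact (iteratedFDeriv_zero_apply _).symm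

/-- On the interior, the Gram function of `D^α` of the feature map is a derivative of `K` of order
`2|α| ≤ 2s`, which by assumption extends continuously to `(x, x)`. Convergence of the Gram function
forces convergence in `H`. -/
lemma KernelIsCk.exists_tendsto (hK : KernelIsCk H (2 * s)) (hX : X ⊆ closure (interior X))
    {α : Fin d → ℕ} (hα : ∑ i, α i ≤ s) {x : EuclideanSpace ℝ (Fin d)} (hx : x ∈ X) :
    ∃ g, Tendsto (iterPDeriv α (featureExt H)) (𝓝[interior X] x) (𝓝 g) := by
  have := mem_closure_iff_nhdsWithin_neBot.1 (hX hx)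
  obtain ⟨m, hm⟩ := (hK.isGramDeriv hα 0).1
  obtain ⟨D, hDc, hDeq⟩ := hK.extends_to (2 * ∑ i, α i) (by lia)
  refine exists_tendsto_of_tendsto_inner (c := D (x, x) m) ?_
  rw [← nhdsWithin_prod_eq]
  have h1 : Tendsto D (𝓝[interior X ×ˢ interior X] (x, x)) (𝓝 (D (x, x))) :=
    (hDc (x, x) ⟨hx, hx⟩).mono (Set.prod_mono interior_subset interior_subset)
  have h2 := ((ContinuousMultilinearMap.apply ℝ (fun _ : Fin (2 * ∑ i, α i) =>
    EuclideanSpace ℝ (Fin d) × EuclideanSpace ℝ (Fin d)) ℝ m).continuous.tendsto _).comp h1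
  refine h2.congr' ?_
  filter_upwards [self_mem_nhdsWithin] with p hp
  rw [hm _ hp.1 _ hp.2, Function.comp_apply, hDeq (by rw [interior_prod_eq]; exact hp)]
  rfl

lemma KernelIsCk.pderivOn_eq_inner_extendFrom (hK : KernelIsCk H (2 * s))
    (hX : X ⊆ closure (interior X)) {α : Fin d → ℕ} (hα : ∑ i, α i ≤ s) (h : H) (x : X) :
    pderivOn α h x = inner ℝ (extendFrom (interior X) (iterPDeriv α (featureExt H)) x) h := by
  refine extendFrom_eq (hX x.2) ?_
  have h1 := tendsto_extendFrom (hK.exists_tendsto hX hα x.2)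
  refine (h1.inner (tendsto_const_nhds (x := h))).congr' ?_
  filter_upwards [self_mem_nhdsWithin] with y hy using ((hK.isGramDeriv hα h).2 y hy).symm

/-- The derivative of `K(·, y)` is the case `h = K(y, ·)` of the reproducing property, so the
continuous extension has the values that the choice in `featureDeriv` prescribes. Elements of `H`
are determined by their values, so the choice is unique. -/
lemma KernelIsCk.featureDeriv_eq (hK : KernelIsCk H (2 * s))
    (hX : X ⊆ closure (interior X)) {α : Fin d → ℕ} (hα : ∑ i, α i ≤ s) (x : X) :
    featureDeriv H α x = extendFrom (interior X) (iterPDeriv α (featureExt H)) x := by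
  have hval : ∀ y : X, extendFrom (interior X) (iterPDeriv α (featureExt H)) x y =
      pderivOn α (fun x' => kern H x' y) x := by
    intro y
    have e : (fun x' => kern H x' y) = ⇑(RKHS.kerFun H y (1 : ℝ)) := by
      ext x'
      rw [RKHS.kerFun_apply, kern]
    rw [e, hK.pderivOn_eq_inner_extendFrom hX hα]
    simp
  have hspec := Classical.epsilon_spec (p := fun g : H => ∀ y : X, g y =
    pderivOn α (fun x' => kern H x' y) x) ⟨_, hval⟩
  refine RKHS.ext fun y => ?_
  rw [hval y]
  exact hspec y

/-- The derivative reproducing property. -/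
lemma KernelIsCk.pderivOn_eq_inner (hK : KernelIsCk H (2 * s))
    (hX : X ⊆ closure (interior X)) {α : Fin d → ℕ} (hα : α ∈ multiIndices d s) (h : H) (x : X) :
    pderivOn α h x = inner ℝ (featureDeriv H α x) h := by
  rw [hK.featureDeriv_eq hX (mem_multiIndices.1 hα),
    hK.pderivOn_eq_inner_extendFrom hX (mem_multiIndices.1 hα)]

lemma KernelIsCk.continuous_featureDeriv (hK : KernelIsCk H (2 * s))
    (hX : X ⊆ closure (interior X)) {α : Fin d → ℕ} (hα : α ∈ multiIndices d s) :
    Continuous (featureDeriv H α) := by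
  have hα' := mem_multiIndices.1 hα
  have h1 : ContinuousOn (extendFrom (interior X) (iterPDeriv α (featureExt H))) X :=
    continuousOn_extendFrom hX fun x hx => hK.exists_tendsto hX hα' hx
  refine (continuousOn_iff_continuous_domRestrict.1 h1).congr fun x => ?_
  exact (hK.featureDeriv_eq hX hα' x).symm

/-- The distance between `K(x, ·)` and `K(y, ·)` is the square root of `K(y, y) - 2 K(y, x) + K(x,
x)`. -/
lemma KernelIsCk.continuous_kerFun (hK : KernelIsCk H (2 * s)) :
    Continuous fun x : X => RKHS.kerFun H x (1 : ℝ) := by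
  have hk : Continuous fun p : X × X => kern H p.1 p.2 := by
    have h1 : Continuous fun p : X × X =>
        kernExt H ((p.1 : EuclideanSpace ℝ (Fin d)), (p.2 : EuclideanSpace ℝ (Fin d))) :=
      hK.continuousOn.comp_continuous (by fun_prop) fun p => ⟨p.1.2, p.2.2⟩
    have e : (fun p : X × X => kern H p.1 p.2) = fun p : X × X =>
        kernExt H ((p.1 : EuclideanSpace ℝ (Fin d)), (p.2 : EuclideanSpace ℝ (Fin d))) := by
      ext p
      rw [kernExt_eq_inner H p.1.2 p.2.2, featureExt_coe, featureExt_coe, kern_eq_inner]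
    rw [e]
    exact h1
  refine continuous_iff_continuousAt.2 fun x => ?_
  rw [ContinuousAt, tendsto_iff_norm_sub_tendsto_zero]
  have h2 : Continuous fun y : X => √(kern H y y - 2 * kern H y x + kern H x x) := by
    have a1 : Continuous fun y : X => kern H y y :=
      hk.comp (g := fun p : X × X => kern H p.1 p.2) (f := fun y : X => (y, y)) (by fun_prop)
    have a2 : Continuous fun y : X => kern H y x :=
      hk.comp (g := fun p : X × X => kern H p.1 p.2) (f := fun y : X => (y, x)) (by fun_prop)
    exact ((a1.sub (continuous_const.mul a2)).add continuous_const).sqrt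
  have h3 := h2.tendsto x
  have e : kern H x x - 2 * kern H x x + kern H x x = 0 := by ring
  rw [e, Real.sqrt_zero] at h3
  refine h3.congr fun y => ?_
  rw [kern_eq_inner, kern_eq_inner, kern_eq_inner, real_inner_self_eq_norm_sq,
    real_inner_self_eq_norm_sq, ← norm_sub_sq_real, Real.sqrt_sq (norm_nonneg _)]

/-- `X` is separable, the feature map is continuous, and its range spans a dense subspace.
Separability of `H` makes Borel measurability behave well for `H`-valued variables and for sequences
of them. -/
lemma KernelIsCk.secondCountableTopology (hK : KernelIsCk H (2 * s)) :
    SecondCountableTopology H := by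
  have hsep : TopologicalSpace.IsSeparable (Set.range fun x : X => RKHS.kerFun H x (1 : ℝ)) :=
    TopologicalSpace.isSeparable_range hK.continuous_kerFun
  have hset : {RKHS.kerFun H x v | (x) (v)} ⊆
      (Submodule.span ℝ (Set.range fun x : X => RKHS.kerFun H x (1 : ℝ)) : Set H) := by
    rintro _ ⟨x, v, rfl⟩
    have e : RKHS.kerFun H x v = v • RKHS.kerFun H x (1 : ℝ) := by
      rw [← map_smul, smul_eq_mul, mul_one]
    rw [e]
    exact Submodule.smul_mem _ _ (Submodule.subset_span ⟨x, rfl⟩)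
  have hdense := RKHS.kerFun_dense (𝕜 := ℝ) H
  have huniv : TopologicalSpace.IsSeparable (Set.univ : Set H) := by
    refine (hsep.span (R := ℝ)).closure.mono ?_
    intro h _
    have hh : h ∈ (Submodule.span ℝ {RKHS.kerFun H x v | (x) (v)}).topologicalClosure := by
      rw [hdense]; trivial
    exact closure_mono (Submodule.span_le.2 hset) hh
  have : TopologicalSpace.SeparableSpace H := TopologicalSpace.isSeparable_univ_iff.1 huniv
  exact UniformSpace.secondCountable_of_separable H

end RKHSDeriv

/-! ### Covariance operators and their resolvents -/

section Hilbert

variable {H : Type*} [NormedAddCommGroup H] [InnerProductSpace ℝ H]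

lemma continuous_rankOne_self :
    Continuous fun x : H => InnerProductSpace.rankOne ℝ x x :=
  ((InnerProductSpace.rankOne ℝ (E := H) (F := H)).continuous).clm_apply continuous_id

/-- With `e = x - y`, the difference is `e ⊗ e + e ⊗ y + y ⊗ e`. The bound involves only the
perturbation and the reference vector `y`. -/
lemma norm_rankOne_self_sub_le (x y : H) :
    ‖InnerProductSpace.rankOne ℝ x x - InnerProductSpace.rankOne ℝ y y‖ ≤
      ‖x - y‖ * (‖x - y‖ + 2 * ‖y‖) := by
  have e : InnerProductSpace.rankOne ℝ x x - InnerProductSpace.rankOne ℝ y y =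
      InnerProductSpace.rankOne ℝ (x - y) (x - y) + InnerProductSpace.rankOne ℝ (x - y) y +
        InnerProductSpace.rankOne ℝ y (x - y) := by
    simp only [map_sub, sub_apply]
    abel
  rw [e]
  refine (norm_add₃_le).trans ?_
  simp only [InnerProductSpace.norm_rankOne]
  nlinarith

variable {Z : Type*} [MeasurableSpace Z] {ν : Measure Z} {f : Z → H}

lemma integrable_rankOne_self (hf : MemLp f 2 ν) :
    Integrable (fun z => InnerProductSpace.rankOne ℝ (f z) (f z)) ν := by
  have h := (memLp_two_iff_integrable_sq_norm hf.1).1 hf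
  refine h.mono (continuous_rankOne_self.comp_aestronglyMeasurable hf.1) (ae_of_all _ fun z => ?_)
  simp [sq]

variable [CompleteSpace H]

/-- Coercivity `⟪(S + lam) x, x⟫ ≥ lam ‖x‖²`, as in the Lax–Milgram theorem; symmetry of `S` plays
no role. -/
lemma isUnit_add_smul_one {S : H →L[ℝ] H} (hS : ∀ u, 0 ≤ inner ℝ (S u) u) {lam : ℝ}
    (hlam : 0 < lam) : IsUnit (S + lam • (1 : H →L[ℝ] H)) := by
  refine ContinuousLinearMap.isUnit_of_forall_le_norm_inner_map _ (c := lam.toNNReal)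
    (Real.toNNReal_pos.2 hlam) fun x => ?_
  have : inner ℝ ((S + lam • (1 : H →L[ℝ] H)) x) x = inner ℝ (S x) x + lam * ‖x‖ ^ 2 := by
    simp [inner_add_left, inner_smul_left]
  rw [this, Real.norm_eq_abs]
  refine le_trans ?_ (le_abs_self _)
  have := hS x
  rw [Real.coe_toNNReal _ hlam.le]
  linarith

lemma add_smul_one_apply_inverse {S : H →L[ℝ] H} (hS : ∀ u, 0 ≤ inner ℝ (S u) u) {lam : ℝ}
    (hlam : 0 < lam) (u : H) :
    (S + lam • (1 : H →L[ℝ] H)) (Ring.inverse (S + lam • (1 : H →L[ℝ] H)) u) = u := by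
  have := Ring.mul_inverse_cancel _ (isUnit_add_smul_one hS hlam)
  exact congrArg (fun T : H →L[ℝ] H => T u) this

lemma inverse_apply_add_smul_one {S : H →L[ℝ] H} (hS : ∀ u, 0 ≤ inner ℝ (S u) u) {lam : ℝ}
    (hlam : 0 < lam) (u : H) :
    Ring.inverse (S + lam • (1 : H →L[ℝ] H)) ((S + lam • (1 : H →L[ℝ] H)) u) = u := by
  have := Ring.inverse_mul_cancel _ (isUnit_add_smul_one hS hlam)
  exact congrArg (fun T : H →L[ℝ] H => T u) this

lemma inner_inverse_comm {S : H →L[ℝ] H} (hS : ∀ u, 0 ≤ inner ℝ (S u) u)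
    (hsymm : ∀ u v, inner ℝ (S u) v = inner ℝ u (S v)) {lam : ℝ} (hlam : 0 < lam) (u v : H) :
    inner ℝ (Ring.inverse (S + lam • (1 : H →L[ℝ] H)) u) v =
      inner ℝ u (Ring.inverse (S + lam • (1 : H →L[ℝ] H)) v) := by
  conv_lhs => rw [← add_smul_one_apply_inverse hS hlam v]
  conv_rhs => rw [← add_smul_one_apply_inverse hS hlam u]
  simp only [add_apply, FunLike.coe_smul, Pi.smul_apply, one_apply_eq_self,
    inner_add_left, inner_add_right, inner_smul_left, inner_smul_right, hsymm]
  simp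

/-- Inversion is continuous at units of a Banach algebra, so positivity matters only for the limit.
-/
lemma tendsto_inverse_add_smul_one {ι : Type*} {l : Filter ι} {T : ι → H →L[ℝ] H}
    {S : H →L[ℝ] H}
    (hS : ∀ u, 0 ≤ inner ℝ (S u) u) {lam : ℝ} (hlam : 0 < lam) (hT : Tendsto T l (𝓝 S)) :
    Tendsto (fun i => Ring.inverse (T i + lam • (1 : H →L[ℝ] H))) l
      (𝓝 (Ring.inverse (S + lam • (1 : H →L[ℝ] H)))) := by
  obtain ⟨w, hw⟩ := isUnit_add_smul_one hS hlam
  have h := NormedRing.inverse_continuousAt w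
  rw [hw] at h
  exact h.tendsto.comp (hT.add_const _)

lemma inner_integral_rankOne_self (hf : MemLp f 2 ν) (u v : H) :
    inner ℝ ((∫ z, InnerProductSpace.rankOne ℝ (f z) (f z) ∂ν) u) v =
      ∫ z, inner ℝ (f z) u * inner ℝ (f z) v ∂ν := by
  have hi := integrable_rankOne_self hf
  rw [ContinuousLinearMap.integral_apply hi, real_inner_comm, ← integral_inner]
  · refine integral_congr_ae (ae_of_all _ fun z => ?_)
    simp [inner_smul_right, real_inner_comm v]
  · exact hi.apply_continuousLinearMap u

/-- If the integrand is not integrable, the Bochner integral is zero; positivity therefore needs no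
moment condition. -/
lemma inner_integral_rankOne_self_nonneg (f : Z → H) (ν : Measure Z) (u : H) :
    0 ≤ inner ℝ ((∫ z, InnerProductSpace.rankOne ℝ (f z) (f z) ∂ν) u) u := by
  by_cases hi : Integrable (fun z => InnerProductSpace.rankOne ℝ (f z) (f z)) ν
  · rw [ContinuousLinearMap.integral_apply hi, real_inner_comm, ← integral_inner]
    · refine integral_nonneg fun z => ?_
      simp only [InnerProductSpace.rankOne_apply, inner_smul_right, real_inner_comm u,
        Pi.zero_apply]
      exact mul_self_nonneg _
    · exact hi.apply_continuousLinearMap u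
  · simp [integral_undef hi]

lemma inner_integral_rankOne_self_comm (f : Z → H) (ν : Measure Z) (u v : H) :
    inner ℝ ((∫ z, InnerProductSpace.rankOne ℝ (f z) (f z) ∂ν) u) v =
      inner ℝ u ((∫ z, InnerProductSpace.rankOne ℝ (f z) (f z) ∂ν) v) := by
  by_cases hi : Integrable (fun z => InnerProductSpace.rankOne ℝ (f z) (f z)) ν
  · rw [ContinuousLinearMap.integral_apply hi, ContinuousLinearMap.integral_apply hi,
      real_inner_comm, ← integral_inner (hi.apply_continuousLinearMap u),
      ← integral_inner (hi.apply_continuousLinearMap v)]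
    refine integral_congr_ae (ae_of_all _ fun z => ?_)
    simp only [InnerProductSpace.rankOne_apply, inner_smul_right, real_inner_comm]
    ring
  · simp [integral_undef hi]

end Hilbert

/-! ### The objective as a quadratic form and its minimizer. -/

section Population

variable {d : ℕ} {X : Set (EuclideanSpace ℝ (Fin d))} {Y : Set ℝ}
  {H : Type*} [NormedAddCommGroup H] [InnerProductSpace ℝ H] [CompleteSpace H] [RKHS ℝ H X ℝ]
  {s : ℕ} {w : (Fin d → ℕ) → X × Y → ℝ} {lam : ℝ} {ν : Measure (X × Y)}

lemma target_eq_inner (hK : KernelIsCk H (2 * s)) (hX : X ⊆ closure (interior X)) (h : H)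
    (z : X × Y) : target s w h z = inner ℝ (psi H s w z) h := by
  rw [target, psi, sum_inner]
  refine Finset.sum_congr rfl fun β hβ => ?_
  rw [hK.pderivOn_eq_inner hX hβ, inner_smul_left]
  rfl

lemma stronglyMeasurable_psi (hK : KernelIsCk H (2 * s)) (hX : X ⊆ closure (interior X))
    (hw : ∀ β ∈ multiIndices d s, Measurable (w β)) : StronglyMeasurable (psi H s w) := by
  refine Finset.stronglyMeasurable_fun_sum _ fun β hβ => ?_
  exact (hw β hβ).stronglyMeasurable.smul
    ((hK.continuous_featureDeriv hX hβ).stronglyMeasurable.comp_measurable measurable_fst)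

lemma inner_covOp_nonneg (u : H) : 0 ≤ inner ℝ (covOp H s w ν u) u :=
  inner_integral_rankOne_self_nonneg _ _ _

lemma inner_covOp_comm (u v : H) : inner ℝ (covOp H s w ν u) v = inner ℝ u (covOp H s w ν v) :=
  inner_integral_rankOne_self_comm _ _ _ _

variable [IsProbabilityMeasure ν]

/-- As `R(h; z) = ⟪ψ(z), h⟫`, its mean is `⟪μ, h⟫` and its variance is `⟪Σ h, h⟫`. -/
lemma objective_eq (hK : KernelIsCk H (2 * s)) (hX : X ⊆ closure (interior X))
    (hψ : MemLp (psi H s w) 2 ν) (h : H) :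
    objective s w lam ν h = -inner ℝ (meanVec H s w ν) h + (1 / 2) * inner ℝ (covOp H s w ν h) h +
      (lam / 2) * ‖h‖ ^ 2 := by
  have hint : Integrable (psi H s w) ν := hψ.integrable (by norm_num)
  have hmean : ∫ z, target s w h z ∂ν = inner ℝ (meanVec H s w ν) h := by
    simp_rw [target_eq_inner hK hX, meanVec]
    rw [real_inner_comm, ← integral_inner hint]
    simp_rw [real_inner_comm]
  have hvar : variance (fun z => target s w h z) ν = inner ℝ (covOp H s w ν h) h := by
    have hsub : MemLp (fun z => psi H s w z - meanVec H s w ν) 2 ν := hψ.sub (memLp_const _)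
    rw [variance_eq_integral, hmean, covOp, inner_integral_rankOne_self hsub]
    · refine integral_congr_ae (ae_of_all _ fun z => ?_)
      simp only [target_eq_inner hK hX, inner_sub_left]
      ring
    · simp_rw [target_eq_inner hK hX]
      exact (hψ.1.inner aestronglyMeasurable_const).aemeasurable
  rw [objective, hmean, hvar]

/-- The minimizer of the objective is `(Σ + lam I)⁻¹ μ`. -/
lemma minimizer_eq (hK : KernelIsCk H (2 * s)) (hX : X ⊆ closure (interior X)) (hlam : 0 < lam)
    (hψ : MemLp (psi H s w) 2 ν) :
    minimizer H s w lam ν = resolventOp H s w lam ν (meanVec H s w ν) := by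
  set h₀ := resolventOp H s w lam ν (meanVec H s w ν) with hh₀
  have hsol : covOp H s w ν h₀ + lam • h₀ = meanVec H s w ν := by
    have : (covOp H s w ν + lam • (1 : H →L[ℝ] H)) h₀ = meanVec H s w ν :=
      add_smul_one_apply_inverse (fun u => inner_covOp_nonneg u) hlam (meanVec H s w ν)
    simpa only [add_apply, FunLike.coe_smul, Pi.smul_apply, one_apply_eq_self] using this
  -- Exact expansion around the critical point `h₀`. It shows both that `h₀` is a minimizer and that
  -- every minimizer, in particular the one chosen by `Classical.epsilon`, equals `h₀`.
  have key : ∀ h : H, objective s w lam ν h - objective s w lam ν h₀ =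
      (1 / 2) * inner ℝ (covOp H s w ν (h - h₀)) (h - h₀) + (lam / 2) * ‖h - h₀‖ ^ 2 := by
    intro h
    have hc := inner_covOp_comm (s := s) (w := w) (ν := ν) h h₀
    rw [objective_eq hK hX hψ, objective_eq hK hX hψ, ← hsol]
    simp only [← real_inner_self_eq_norm_sq, map_sub, inner_sub_left, inner_sub_right,
      inner_add_left, inner_smul_left, RCLike.conj_to_real, hc]
    rw [real_inner_comm h h₀, real_inner_comm (covOp H s w ν h₀) h]
    ring
  have hmin : ∀ g : H, objective s w lam ν h₀ ≤ objective s w lam ν g := by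
    intro g
    have h1 := key g
    have h2 := inner_covOp_nonneg (s := s) (w := w) (ν := ν) (g - h₀)
    have h3 : 0 ≤ (lam / 2) * ‖g - h₀‖ ^ 2 := by positivity
    linarith
  have hspec := Classical.epsilon_spec
    (p := fun h : H => ∀ g : H, objective s w lam ν h ≤ objective s w lam ν g) ⟨h₀, hmin⟩
  have h1 := key (minimizer H s w lam ν)
  have h2 := inner_covOp_nonneg (s := s) (w := w) (ν := ν) (minimizer H s w lam ν - h₀)
  have h3 : objective s w lam ν (minimizer H s w lam ν) ≤ objective s w lam ν h₀ := hspec h₀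
  have h4 : (lam / 2) * ‖minimizer H s w lam ν - h₀‖ ^ 2 ≤ 0 := by linarith
  have h5 : ‖minimizer H s w lam ν - h₀‖ ^ 2 ≤ 0 := nonpos_of_mul_nonpos_right h4 (by positivity)
  have h6 : ‖minimizer H s w lam ν - h₀‖ = 0 := by
    nlinarith [norm_nonneg (minimizer H s w lam ν - h₀)]
  exact sub_eq_zero.1 (norm_eq_zero.1 h6)

/-- The form `xᵀ Ω x` is `⟪Q v, v⟫` with `v = ∑ x_j u_j`. Nothing is required of `ν`, so the
empirical measure with `N = 0` is covered. -/
lemma posSemidef_Omega (ν : Measure (X × Y)) (α : Fin d → ℕ) {n : ℕ} (ξ : Fin n → X) :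
    (Omega H s w lam α ξ ν).PosSemidef := by
  refine Matrix.PosSemidef.of_dotProduct_mulVec_nonneg ?_ fun x => ?_
  · ext k j
    simp only [Omega, Matrix.conjTranspose_apply, Matrix.of_apply, star_trivial]
    rw [fluctuationCov, ← inner_integral_rankOne_self_comm, real_inner_comm]
  · have e : star x ⬝ᵥ (Omega H s w lam α ξ ν).mulVec x =
        inner ℝ (fluctuationCov H s w lam ν
          (∑ j, x j • resolventOp H s w lam ν (featureDeriv H α (ξ j))))
          (∑ j, x j • resolventOp H s w lam ν (featureDeriv H α (ξ j))) := by
      rw [real_inner_comm, sum_inner]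
      simp only [dotProduct, Matrix.mulVec, Omega, Matrix.of_apply, map_sum, map_smul, inner_sum,
        inner_smul_left, inner_smul_right, star_trivial, Pi.star_apply, RCLike.conj_to_real]
      refine Finset.sum_congr rfl fun k _ => ?_
      rw [Finset.mul_sum]
      refine Finset.sum_congr rfl fun j _ => ?_
      ring
    rw [e]
    exact inner_integral_rankOne_self_nonneg _ _ _

end Population

/-! ### Sample statistics as functions of the feature vectors -/

/-- The average `N⁻¹ ∑_{i < N} x_i`. -/
def avg {F : Type*} [NormedAddCommGroup F] [NormedSpace ℝ F] (N : ℕ) (x : ℕ → F) : F :=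
  (N : ℝ)⁻¹ • ∑ i ∈ Finset.range N, x i

section Avg

variable {F G : Type*} [NormedAddCommGroup F] [NormedSpace ℝ F] [NormedAddCommGroup G]
  [NormedSpace ℝ G]

lemma avg_sub (N : ℕ) (x y : ℕ → F) : avg N (fun i => x i - y i) = avg N x - avg N y := by
  simp [avg, Finset.sum_sub_distrib, smul_sub]

lemma avg_const {N : ℕ} (hN : N ≠ 0) (c : F) : avg N (fun _ => c) = c := by
  have : (N : ℝ) ≠ 0 := Nat.cast_ne_zero.2 hN
  rw [avg, Finset.sum_const, Finset.card_range, ← Nat.cast_smul_eq_nsmul ℝ, smul_smul,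
    inv_mul_cancel₀ this, one_smul]

lemma map_avg (T : F →L[ℝ] G) (N : ℕ) (x : ℕ → F) : T (avg N x) = avg N fun i => T (x i) := by
  simp [avg]

lemma norm_avg_le (N : ℕ) (x : ℕ → F) : ‖avg N x‖ ≤ avg N fun i => ‖x i‖ := by
  rw [avg, avg, norm_smul, norm_inv, Real.norm_natCast, smul_eq_mul]
  gcongr
  exact norm_sum_le _ _

lemma avg_mono {N : ℕ} {x y : ℕ → ℝ} (h : ∀ i, x i ≤ y i) : avg N x ≤ avg N y := by
  rw [avg, avg, smul_eq_mul, smul_eq_mul]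
  gcongr with i
  exact h i

lemma avg_const_mul (N : ℕ) (c : ℝ) (x : ℕ → ℝ) : avg N (fun i => c * x i) = c * avg N x := by
  simp only [avg, ← Finset.mul_sum, smul_eq_mul]
  ring

lemma continuous_avg {T : Type*} [TopologicalSpace T] {N : ℕ} {f : T → ℕ → F}
    (hf : ∀ i, Continuous fun t => f t i) : Continuous fun t => avg N (f t) :=
  (continuous_finsetSum _ fun i _ => hf i).const_smul _

/-- This includes `N = 0`: the measure `⊤ • 0` is zero, and so is the average `0⁻¹ • 0`. -/
lemma integral_empirical [CompleteSpace F] {Z : Type*} [MeasurableSpace Z]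
    [MeasurableSingletonClass Z] (N : ℕ) (z : ℕ → Z) (f : Z → F) :
    ∫ a, f a ∂(empirical N z) = avg N fun i => f (z i) := by
  rw [empirical, integral_smul_measure, integral_finsetSum_measure]
  · simp [avg]
  · exact fun i _ => integrable_dirac (by simp)

lemma integrable_empirical {F : Type*} [NormedAddCommGroup F] {Z : Type*} [MeasurableSpace Z]
    [MeasurableSingletonClass Z] {N : ℕ} (hN : N ≠ 0) (z : ℕ → Z) (f : Z → F) :
    Integrable f (empirical N z) := by
  refine Integrable.smul_measure ?_ (by simpa using hN)
  exact integrable_finsetSum_measure.2 fun i _ => integrable_dirac (by simp)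

lemma isProbabilityMeasure_empirical {Z : Type*} [MeasurableSpace Z] {N : ℕ} (hN : N ≠ 0)
    (z : ℕ → Z) : IsProbabilityMeasure (empirical N z) := by
  constructor
  simp only [empirical, Measure.smul_apply, Measure.finsetSum_apply, measure_univ,
    Finset.sum_const, Finset.card_range, smul_eq_mul, nsmul_eq_mul, mul_one]
  exact ENNReal.inv_mul_cancel (by simpa using hN) (by simp)

end Avg

/-! ### Algebra, continuity and perturbation bounds for the sample quantities. -/

section Sample

variable {H : Type*} [NormedAddCommGroup H] [InnerProductSpace ℝ H]

/-- `x - m - ((x - m) ⊗ (x - m) - S) h`. -/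
def fluct (m : H) (S : H →L[ℝ] H) (h x : H) : H :=
  (x - m) - (InnerProductSpace.rankOne ℝ (x - m) (x - m) - S) h

/-- The sample covariance operator. -/
def sampleCov (N : ℕ) (x : ℕ → H) : H →L[ℝ] H :=
  avg N fun i => InnerProductSpace.rankOne ℝ (x i - avg N x) (x i - avg N x)

/-- The resolvent of the sample covariance operator. -/
def sampleRes (lam : ℝ) (N : ℕ) (x : ℕ → H) : H →L[ℝ] H :=
  Ring.inverse (sampleCov N x + lam • (1 : H →L[ℝ] H))

/-- The minimizer of the sample objective. -/
def sampleMin (lam : ℝ) (N : ℕ) (x : ℕ → H) : H := sampleRes lam N x (avg N x)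

/-- The sample version of the operator `Q`. -/
def sampleQ (lam : ℝ) (N : ℕ) (x : ℕ → H) : H →L[ℝ] H :=
  avg N fun i => InnerProductSpace.rankOne ℝ
    (fluct (avg N x) (sampleCov N x) (sampleMin lam N x) (x i))
    (fluct (avg N x) (sampleCov N x) (sampleMin lam N x) (x i))

lemma inner_avg_rankOne_nonneg (N : ℕ) (y : ℕ → H) (u : H) :
    0 ≤ inner ℝ ((avg N fun i => InnerProductSpace.rankOne ℝ (y i) (y i)) u) u := by
  have e : inner ℝ ((avg N fun i => InnerProductSpace.rankOne ℝ (y i) (y i)) u) u =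
      (N : ℝ)⁻¹ * ∑ i ∈ Finset.range N, inner ℝ (y i) u ^ 2 := by
    simp [avg, sum_inner, inner_smul_left, sq]
  rw [e]
  positivity

lemma inner_avg_rankOne_comm (N : ℕ) (y : ℕ → H) (u v : H) :
    inner ℝ ((avg N fun i => InnerProductSpace.rankOne ℝ (y i) (y i)) u) v =
      inner ℝ u ((avg N fun i => InnerProductSpace.rankOne ℝ (y i) (y i)) v) := by
  simp only [avg, FunLike.coe_smul, Pi.smul_apply, FunLike.coe_sum, Finset.sum_apply,
    InnerProductSpace.rankOne_apply, inner_smul_left, inner_smul_right, sum_inner, inner_sum,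
    RCLike.conj_to_real]
  congr 1
  refine Finset.sum_congr rfl fun i _ => ?_
  rw [real_inner_comm (y i) u]
  ring

variable {lam : ℝ}

lemma inner_sampleRes_comm [CompleteSpace H] (hlam : 0 < lam) (N : ℕ) (x : ℕ → H) (u v : H) :
    inner ℝ (sampleRes lam N x u) v = inner ℝ u (sampleRes lam N x v) :=
  inner_inverse_comm (inner_avg_rankOne_nonneg _ _) (inner_avg_rankOne_comm _ _) hlam u v

/-- Continuity of the statistics for the product topology on sequences later supplies their
measurability. -/
lemma continuous_sampleCov (N : ℕ) : Continuous (sampleCov (H := H) N) := by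
  have h1 : Continuous fun x : ℕ → H => avg N x := continuous_avg fun i => continuous_apply i
  exact continuous_avg fun i => continuous_rankOne_self.comp ((continuous_apply i).sub h1)

lemma continuous_sampleRes [CompleteSpace H] (hlam : 0 < lam) (N : ℕ) :
    Continuous (sampleRes (H := H) lam N) :=
  continuous_iff_continuousAt.2 fun x =>
    tendsto_inverse_add_smul_one (inner_avg_rankOne_nonneg _ _) hlam
      ((continuous_sampleCov N).tendsto x)

lemma continuous_sampleMin [CompleteSpace H] (hlam : 0 < lam) (N : ℕ) :
    Continuous (sampleMin (H := H) lam N) :=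
  (continuous_sampleRes hlam N).clm_apply (continuous_avg fun i => continuous_apply i)

lemma continuous_sampleQ [CompleteSpace H] (hlam : 0 < lam) (N : ℕ) :
    Continuous (sampleQ (H := H) lam N) := by
  have h1 : Continuous fun x : ℕ → H => avg N x := continuous_avg fun i => continuous_apply i
  refine continuous_avg fun i => continuous_rankOne_self.comp ?_
  have h2 : Continuous fun x : ℕ → H => x i - avg N x := (continuous_apply i).sub h1
  exact h2.sub (((continuous_rankOne_self.comp h2).sub (continuous_sampleCov N)).clm_apply
    (continuous_sampleMin hlam N))

/-- The sample covariance is the average of centred tensors minus a rank one correction. -/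
lemma sampleCov_eq {N : ℕ} (hN : N ≠ 0) (x : ℕ → H) (m : H) :
    sampleCov N x = (avg N fun i => InnerProductSpace.rankOne ℝ (x i - m) (x i - m)) -
      InnerProductSpace.rankOne ℝ (avg N x - m) (avg N x - m) := by
  set δ := avg N x - m with hδ
  -- Centring at `m` in place of the sample mean; by bilinearity both cross terms average to `δ ⊗
  -- δ`.
  have e : ∀ i, InnerProductSpace.rankOne ℝ (x i - avg N x) (x i - avg N x) =
      InnerProductSpace.rankOne ℝ (x i - m) (x i - m) -
        InnerProductSpace.rankOne ℝ (x i - m) δ -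
        (InnerProductSpace.rankOne ℝ δ (x i - m) - InnerProductSpace.rankOne ℝ δ δ) := by
    intro i
    have : x i - avg N x = (x i - m) - δ := by rw [hδ]; abel
    rw [this]
    simp only [map_sub, sub_apply]
    abel
  have hm : avg N (fun i => x i - m) = δ := by rw [avg_sub, avg_const hN]
  have e1 : avg N (fun i => InnerProductSpace.rankOne ℝ (x i - m) δ) =
      InnerProductSpace.rankOne ℝ δ δ := by
    have := map_avg ((InnerProductSpace.rankOne ℝ (E := H) (F := H)).flip δ) N fun i => x i - m
    rw [hm] at this
    exact this.symm
  have e2 : avg N (fun i => InnerProductSpace.rankOne ℝ δ (x i - m)) =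
      InnerProductSpace.rankOne ℝ δ δ := by
    have := map_avg (InnerProductSpace.rankOne ℝ (E := H) (F := H) δ) N fun i => x i - m
    rw [hm] at this
    exact this.symm
  rw [sampleCov]
  simp_rw [e]
  rw [avg_sub, avg_sub, avg_sub, e1, e2, avg_const hN]
  abel

/-- The estimating equation for the sample minimizer. -/
lemma sampleMin_sub_eq [CompleteSpace H] (hlam : 0 < lam) {N : ℕ} (hN : N ≠ 0) (x : ℕ → H)
    {m h : H}
    {S : H →L[ℝ] H} (hh : S h + lam • h = m) :
    sampleMin lam N x - h = sampleRes lam N x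
      (avg N (fun i => fluct m S h (x i)) + inner ℝ (avg N x - m) h • (avg N x - m)) := by
  -- Once `h` is written as the sample resolvent of `Σ̂ h + lam h`, only `μ̂ - Σ̂ h - lam h = (μ̂ -
  -- m) - (Σ̂ - S) h` is left under the resolvent. The rank one correction in `sampleCov_eq`
  -- produces the term quadratic in `μ̂ - m`.
  have h1 : h = sampleRes lam N x (sampleCov N x h + lam • h) := by
    exact (inverse_apply_add_smul_one (S := sampleCov N x) (inner_avg_rankOne_nonneg _ _) hlam
      h).symm
  conv_lhs => rw [h1]
  rw [sampleMin, ← map_sub]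
  congr 1
  have e : avg N (fun i => fluct m S h (x i)) = (avg N x - m) -
      ((avg N fun i => InnerProductSpace.rankOne ℝ (x i - m) (x i - m)) h - S h) := by
    have e2 := map_avg (ContinuousLinearMap.apply ℝ H h) N
      fun i => InnerProductSpace.rankOne ℝ (x i - m) (x i - m)
    simp only [ContinuousLinearMap.apply_apply] at e2
    simp only [fluct, sub_apply]
    rw [avg_sub, avg_sub, avg_sub, avg_const hN, avg_const hN, e2]
  rw [e, sampleCov_eq hN x m, ← hh, sub_apply, InnerProductSpace.rankOne_apply]
  abel

/-- The effect on `fluct` of perturbing its parameters grows at most quadratically in `x`. -/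
lemma norm_fluct_sub_le (m m' h h' x : H) (S S' : H →L[ℝ] H) :
    ‖fluct m' S' h' x - fluct m S h x‖ ≤
      (‖m' - m‖ + (1 + ‖m'‖) * ‖h'‖ * ‖m' - m‖ + (1 + ‖m'‖) * (1 + ‖m‖) * ‖h' - h‖ +
        ‖m' - m‖ * ‖h‖ * (1 + ‖m‖) + ‖S' h' - S h‖) * (1 + ‖x‖) ^ 2 := by
  -- The parameters are changed one at a time, so each term contains the difference of one pair and
  -- is at most quadratic in `x`.
  have e : fluct m' S' h' x - fluct m S h x = -(m' - m) + inner ℝ (x - m') h' • (m' - m) -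
      inner ℝ (x - m') (h' - h) • (x - m) + inner ℝ (m' - m) h • (x - m) + (S' h' - S h) := by
    simp only [fluct, sub_apply, InnerProductSpace.rankOne_apply, inner_sub_left, inner_sub_right,
      sub_smul, smul_sub]
    abel
  have hx := norm_nonneg x
  have hm := norm_nonneg m
  have hm' := norm_nonneg m'
  have p1 : (1 : ℝ) ≤ 1 + ‖x‖ := by linarith
  have a1 : ‖x - m‖ ≤ (1 + ‖m‖) * (1 + ‖x‖) := by
    refine (norm_sub_le _ _).trans ?_
    nlinarith [mul_nonneg hx hm]
  have a2 : ‖x - m'‖ ≤ (1 + ‖m'‖) * (1 + ‖x‖) := by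
    refine (norm_sub_le _ _).trans ?_
    nlinarith [mul_nonneg hx hm']
  have p2 : (1 + ‖x‖) ≤ (1 + ‖x‖) ^ 2 := by nlinarith
  have p3 : 1 ≤ (1 + ‖x‖) ^ 2 := by nlinarith
  have b1 : ‖-(m' - m)‖ ≤ ‖m' - m‖ * (1 + ‖x‖) ^ 2 := by
    rw [norm_neg]
    exact le_mul_of_one_le_right (norm_nonneg _) p3
  have b2 : ‖inner ℝ (x - m') h' • (m' - m)‖ ≤
      (1 + ‖m'‖) * ‖h'‖ * ‖m' - m‖ * (1 + ‖x‖) ^ 2 := by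
    rw [norm_smul]
    calc _ ≤ (‖x - m'‖ * ‖h'‖) * ‖m' - m‖ := by gcongr; exact norm_inner_le_norm _ _
      _ ≤ ((1 + ‖m'‖) * (1 + ‖x‖) * ‖h'‖) * ‖m' - m‖ := by gcongr
      _ = ((1 + ‖m'‖) * ‖h'‖ * ‖m' - m‖) * (1 + ‖x‖) := by ring
      _ ≤ _ := by gcongr
  have b3 : ‖inner ℝ (x - m') (h' - h) • (x - m)‖ ≤
      (1 + ‖m'‖) * (1 + ‖m‖) * ‖h' - h‖ * (1 + ‖x‖) ^ 2 := by
    rw [norm_smul]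
    calc _ ≤ (‖x - m'‖ * ‖h' - h‖) * ‖x - m‖ := by gcongr; exact norm_inner_le_norm _ _
      _ ≤ ((1 + ‖m'‖) * (1 + ‖x‖) * ‖h' - h‖) * ((1 + ‖m‖) * (1 + ‖x‖)) := by gcongr
      _ = _ := by ring
  have b4 : ‖inner ℝ (m' - m) h • (x - m)‖ ≤
      ‖m' - m‖ * ‖h‖ * (1 + ‖m‖) * (1 + ‖x‖) ^ 2 := by
    rw [norm_smul]
    calc _ ≤ (‖m' - m‖ * ‖h‖) * ‖x - m‖ := by gcongr; exact norm_inner_le_norm _ _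
      _ ≤ (‖m' - m‖ * ‖h‖) * ((1 + ‖m‖) * (1 + ‖x‖)) := by gcongr
      _ = (‖m' - m‖ * ‖h‖ * (1 + ‖m‖)) * (1 + ‖x‖) := by ring
      _ ≤ _ := by gcongr
  have b5 : ‖S' h' - S h‖ ≤ ‖S' h' - S h‖ * (1 + ‖x‖) ^ 2 :=
    le_mul_of_one_le_right (norm_nonneg _) p3
  rw [e]
  calc _ ≤ ‖-(m' - m)‖ + ‖inner ℝ (x - m') h' • (m' - m)‖ +
        ‖inner ℝ (x - m') (h' - h) • (x - m)‖ + ‖inner ℝ (m' - m) h • (x - m)‖ +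
        ‖S' h' - S h‖ := by
        refine (norm_add_le _ _).trans ?_
        gcongr
        refine (norm_add_le _ _).trans ?_
        gcongr
        refine (norm_sub_le _ _).trans ?_
        gcongr
        exact norm_add_le _ _
    _ ≤ _ := by linarith

/-- Quadratic growth of `F` in `ψ` is the reason for assuming a fourth moment: it makes `F` square
integrable. -/
lemma norm_fluct_le (m h x : H) (S : H →L[ℝ] H) :
    ‖fluct m S h x‖ ≤ ((1 + ‖m‖) + (1 + ‖m‖) ^ 2 * ‖h‖ + ‖S h‖) * (1 + ‖x‖) ^ 2 := by
  have hx := norm_nonneg x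
  have hm := norm_nonneg m
  have p2 : (1 + ‖x‖) ≤ (1 + ‖x‖) ^ 2 := by nlinarith
  have p3 : 1 ≤ (1 + ‖x‖) ^ 2 := by nlinarith
  have a1 : ‖x - m‖ ≤ (1 + ‖m‖) * (1 + ‖x‖) := by
    refine (norm_sub_le _ _).trans ?_
    nlinarith [mul_nonneg hx hm]
  have e : fluct m S h x = (x - m) - inner ℝ (x - m) h • (x - m) + S h := by
    simp only [fluct, sub_apply, InnerProductSpace.rankOne_apply]
    abel
  rw [e]
  have b2 : ‖inner ℝ (x - m) h • (x - m)‖ ≤ (1 + ‖m‖) ^ 2 * ‖h‖ * (1 + ‖x‖) ^ 2 := by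
    rw [norm_smul]
    calc _ ≤ (‖x - m‖ * ‖h‖) * ‖x - m‖ := by gcongr; exact norm_inner_le_norm _ _
      _ ≤ ((1 + ‖m‖) * (1 + ‖x‖) * ‖h‖) * ((1 + ‖m‖) * (1 + ‖x‖)) := by gcongr
      _ = _ := by ring
  calc _ ≤ ‖x - m‖ + ‖inner ℝ (x - m) h • (x - m)‖ + ‖S h‖ := by
        refine (norm_add_le _ _).trans ?_
        gcongr
        exact norm_sub_le _ _
    _ ≤ (1 + ‖m‖) * (1 + ‖x‖) ^ 2 + (1 + ‖m‖) ^ 2 * ‖h‖ * (1 + ‖x‖) ^ 2 +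
        ‖S h‖ * (1 + ‖x‖) ^ 2 := by
        gcongr
        · exact a1.trans (by gcongr)
        · exact le_mul_of_one_le_right (norm_nonneg _) p3
    _ = _ := by ring

lemma continuous_fluct (m h : H) (S : H →L[ℝ] H) : Continuous (fluct m S h) := by
  have h2 : Continuous fun x : H => x - m := by fun_prop
  exact h2.sub (((continuous_rankOne_self.comp h2).sub continuous_const).clm_apply
    continuous_const)

/-! ### Deterministic consistency along a sequence whose averages converge. -/

section Consistency

variable {x : ℕ → H} {m : H} {S : H →L[ℝ] H}

lemma tendsto_sampleCov (h1 : Tendsto (fun N => avg N x) atTop (𝓝 m))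
    (h2 : Tendsto (fun N => avg N fun i => InnerProductSpace.rankOne ℝ (x i - m) (x i - m)) atTop
      (𝓝 S)) : Tendsto (fun N => sampleCov N x) atTop (𝓝 S) := by
  have h3 : Tendsto (fun N => avg N x - m) atTop (𝓝 0) := by simpa using h1.sub_const m
  have h4 := h2.sub ((continuous_rankOne_self.tendsto 0).comp h3)
  simp only [map_zero, sub_zero] at h4
  refine h4.congr' ?_
  filter_upwards [eventually_ne_atTop 0] with N hN using (sampleCov_eq hN x m).symm

lemma tendsto_clm_apply {ι : Type*} {l : Filter ι} {T : ι → H →L[ℝ] H} {u : ι → H} {v : H}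
    (hT : Tendsto T l (𝓝 S)) (hu : Tendsto u l (𝓝 v)) :
    Tendsto (fun i => T i (u i)) l (𝓝 (S v)) :=
  (isBoundedBilinearMap_apply.continuous.tendsto (S, v)).comp (hT.prodMk_nhds hu)

lemma tendsto_sampleRes [CompleteSpace H] (hS : ∀ u, 0 ≤ inner ℝ (S u) u) (hlam : 0 < lam)
    (h1 : Tendsto (fun N => avg N x) atTop (𝓝 m))
    (h2 : Tendsto (fun N => avg N fun i => InnerProductSpace.rankOne ℝ (x i - m) (x i - m)) atTop
      (𝓝 S)) :
    Tendsto (fun N => sampleRes lam N x) atTop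
    (𝓝 (Ring.inverse (S + lam • (1 : H →L[ℝ] H)))) :=
  tendsto_inverse_add_smul_one hS hlam (tendsto_sampleCov h1 h2)

lemma tendsto_sampleMin [CompleteSpace H] (hS : ∀ u, 0 ≤ inner ℝ (S u) u) (hlam : 0 < lam)
    (h1 : Tendsto (fun N => avg N x) atTop (𝓝 m))
    (h2 : Tendsto (fun N => avg N fun i => InnerProductSpace.rankOne ℝ (x i - m) (x i - m)) atTop
      (𝓝 S)) :
    Tendsto (fun N => sampleMin lam N x) atTop
    (𝓝 (Ring.inverse (S + lam • (1 : H →L[ℝ] H)) m)) :=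
  tendsto_clm_apply (tendsto_sampleRes hS hlam h1 h2) h1

/-- The summands of `sampleQ` contain estimated parameters, so the law of large numbers does not
apply to them directly. They are compared with the summands at the true parameters; the error is a
null sequence times the average of `(1 + ‖x i‖) ^ 4`. -/
lemma tendsto_sampleQ [CompleteSpace H] (hS : ∀ u, 0 ≤ inner ℝ (S u) u) (hlam : 0 < lam)
    (h1 : Tendsto (fun N => avg N x) atTop (𝓝 m))
    (h2 : Tendsto (fun N => avg N fun i => InnerProductSpace.rankOne ℝ (x i - m) (x i - m)) atTop
      (𝓝 S))
    {C : ℝ} {Q : H →L[ℝ] H} {h : H}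
    (hh : h = Ring.inverse (S + lam • (1 : H →L[ℝ] H)) m)
    (h3 : Tendsto (fun N => avg N fun i => (1 + ‖x i‖) ^ 4) atTop (𝓝 C))
    (h4 : Tendsto (fun N => avg N fun i =>
      InnerProductSpace.rankOne ℝ (fluct m S h (x i)) (fluct m S h (x i))) atTop (𝓝 Q)) :
    Tendsto (fun N => sampleQ lam N x) atTop (𝓝 Q) := by
  have hmin : Tendsto (fun N => sampleMin lam N x) atTop (𝓝 h) := by
    rw [hh]; exact tendsto_sampleMin hS hlam h1 h2
  have hcov := tendsto_sampleCov h1 h2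
  set e : ℕ → ℝ := fun N => ‖avg N x - m‖ +
    (1 + ‖avg N x‖) * ‖sampleMin lam N x‖ * ‖avg N x - m‖ +
    (1 + ‖avg N x‖) * (1 + ‖m‖) * ‖sampleMin lam N x - h‖ +
    ‖avg N x - m‖ * ‖h‖ * (1 + ‖m‖) + ‖sampleCov N x (sampleMin lam N x) - S h‖ with he
  have he0 : Tendsto e atTop (𝓝 0) := by
    have d1 : Tendsto (fun N => ‖avg N x - m‖) atTop (𝓝 0) := by
      simpa using (h1.sub_const m).norm
    have d2 : Tendsto (fun N => ‖sampleMin lam N x - h‖) atTop (𝓝 0) := by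
      simpa using (hmin.sub_const h).norm
    have d3 : Tendsto (fun N => ‖sampleCov N x (sampleMin lam N x) - S h‖) atTop (𝓝 0) := by
      simpa using ((tendsto_clm_apply hcov hmin).sub_const (S h)).norm
    have d4 : Tendsto (fun N => 1 + ‖avg N x‖) atTop (𝓝 (1 + ‖m‖)) := h1.norm.const_add 1
    have := (((d1.add ((d4.mul hmin.norm).mul d1)).add ((d4.mul_const (1 + ‖m‖)).mul d2)).add
      ((d1.mul_const ‖h‖).mul_const (1 + ‖m‖))).add d3
    simpa using this
  set c : ℝ := (1 + ‖m‖) + (1 + ‖m‖) ^ 2 * ‖h‖ + ‖S h‖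
  have hdiff : Tendsto (fun N => sampleQ lam N x - avg N fun i =>
      InnerProductSpace.rankOne ℝ (fluct m S h (x i)) (fluct m S h (x i))) atTop (𝓝 0) := by
    refine squeeze_zero_norm (a := fun N => e N * (e N + 2 * c) * avg N fun i => (1 + ‖x i‖) ^ 4)
      (fun N => ?_) ?_
    · rw [sampleQ, ← avg_sub, ← avg_const_mul]
      refine (norm_avg_le _ _).trans (avg_mono fun i => ?_)
      refine (norm_rankOne_self_sub_le _ _).trans ?_
      have b1 := norm_fluct_sub_le m (avg N x) h (sampleMin lam N x) (x i) S (sampleCov N x)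
      have b2 := norm_fluct_le m h (x i) S
      have e0 : 0 ≤ e N := by positivity
      calc _ ≤ (e N * (1 + ‖x i‖) ^ 2) *
            (e N * (1 + ‖x i‖) ^ 2 + 2 * (c * (1 + ‖x i‖) ^ 2)) := by gcongr
        _ = _ := by ring
    · have := (he0.mul (he0.add_const (2 * c))).mul h3
      simpa using this
  simpa using hdiff.add h4

end Consistency

end Sample

/-! ### Quadratic distance to the orthant -/

section Cone

variable {n : ℕ} {B : Matrix (Fin n) (Fin n) ℝ}

/-- The squared distance `inf_{c ∈ ℝ^n_+} (v - c)ᵀ B (v - c)` to the orthant. -/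
def orthantDist (B : Matrix (Fin n) (Fin n) ℝ) (v : EuclideanSpace ℝ (Fin n)) : ℝ :=
  ⨅ c : orthant n, quad B (v - c)

instance : Nonempty (orthant n) := ⟨⟨0, fun _ => le_rfl⟩⟩

open scoped MatrixOrder in
/-- A positive definite quadratic form is the squared Euclidean norm in other coordinates. -/
lemma exists_equiv_dotProduct_mulVec (hB : B.PosDef) :
    ∃ T : EuclideanSpace ℝ (Fin n) ≃L[ℝ] EuclideanSpace ℝ (Fin n),
      ∀ x y, x.ofLp ⬝ᵥ B.mulVec y.ofLp = inner ℝ (T x) (T y) := by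
  set R := CFC.sqrt B with hR
  have hRR : R * R = B := CFC.sqrt_mul_sqrt_self _ hB.posSemidef.nonneg
  have hRu : IsUnit R := isUnit_of_mul_isUnit_left (hRR ▸ hB.isUnit)
  obtain ⟨u, hu⟩ := hRu.map (Matrix.toEuclideanCLM (n := Fin n) (𝕜 := ℝ))
  have hsa : IsSelfAdjoint (Matrix.toEuclideanCLM (n := Fin n) (𝕜 := ℝ) R) :=
    (CFC.sqrt_nonneg B).isSelfAdjoint.map _
  refine ⟨ContinuousLinearEquiv.unitsEquiv ℝ _ u, fun x y => ?_⟩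
  have e : ∀ x, ContinuousLinearEquiv.unitsEquiv ℝ _ u x =
      Matrix.toEuclideanCLM (n := Fin n) (𝕜 := ℝ) R x := fun x => by rw [← hu]; rfl
  rw [e, e, ← ContinuousLinearMap.adjoint_inner_right, hsa.adjoint_eq,
    ← mul_apply_eq_comp, ← map_mul, hRR, Matrix.inner_toEuclideanCLM]

lemma quad_smul (B : Matrix (Fin n) (Fin n) ℝ) (a : ℝ) (v : EuclideanSpace ℝ (Fin n)) :
    quad B (a • v) = a ^ 2 * quad B v := by
  simp only [quad, WithLp.ofLp_smul, Matrix.mulVec_smul, smul_dotProduct, dotProduct_smul,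
    smul_eq_mul]
  ring

lemma quad_nonneg (hB : B.PosSemidef) (v : EuclideanSpace ℝ (Fin n)) : 0 ≤ quad B v := by
  simpa [quad] using hB.dotProduct_mulVec_nonneg v.ofLp

lemma continuous_quad (B : Matrix (Fin n) (Fin n) ℝ) : Continuous (quad B) := by
  unfold quad
  fun_prop

lemma bddBelow_quad_sub (hB : B.PosSemidef) (v : EuclideanSpace ℝ (Fin n)) :
    BddBelow (Set.range fun c : orthant n => quad B (v - c)) :=
  ⟨0, by rintro _ ⟨c, rfl⟩; exact quad_nonneg hB _⟩

lemma isClosed_orthant (n : ℕ) : IsClosed (orthant n) := by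
  have : orthant n = ⋂ j, {c : EuclideanSpace ℝ (Fin n) | 0 ≤ c j} := by
    ext c; simp [orthant]
  rw [this]
  exact isClosed_iInter fun j => isClosed_le continuous_const (by fun_prop)

/-- In the coordinates `T` the form is the squared Euclidean distance, and the image of the orthant
is closed, so a nearest point exists. -/
lemma exists_quad_sub_eq_infDist (T : EuclideanSpace ℝ (Fin n) ≃L[ℝ] EuclideanSpace ℝ (Fin n))
    (hT : ∀ x y, x.ofLp ⬝ᵥ B.mulVec y.ofLp = inner ℝ (T x) (T y))
    (v : EuclideanSpace ℝ (Fin n)) :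
    ∃ c₀ ∈ orthant n, (∀ c ∈ orthant n, quad B (v - c₀) ≤ quad B (v - c)) ∧
      quad B (v - c₀) = Metric.infDist (T v) (T '' orthant n) ^ 2 := by
  have hcl : IsClosed (T '' orthant n) := T.toHomeomorph.isClosed_image.2 (isClosed_orthant n)
  have hq : ∀ c, quad B (v - c) = dist (T v) (T c) ^ 2 := fun c => by
    rw [quad, hT, real_inner_self_eq_norm_sq, map_sub, dist_eq_norm]
  obtain ⟨_, ⟨c₀, hc₀, rfl⟩, h⟩ := hcl.exists_infDist_eq_dist
    ⟨T 0, 0, fun _ => le_rfl, rfl⟩ (T v)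
  refine ⟨c₀, hc₀, fun c hc => ?_, by rw [hq, h]⟩
  rw [hq, hq, ← h]
  exact pow_le_pow_left₀ Metric.infDist_nonneg
    (Metric.infDist_le_dist_of_mem (Set.mem_image_of_mem T hc)) 2

lemma isLeast_orthantDist (hB : B.PosDef) (v : EuclideanSpace ℝ (Fin n)) :
    IsLeast ((fun c => quad B (v - c)) '' orthant n) (orthantDist B v) := by
  obtain ⟨T, hT⟩ := exists_equiv_dotProduct_mulVec hB
  obtain ⟨c₀, hc₀, hmin, -⟩ := exists_quad_sub_eq_infDist T hT v
  have e : orthantDist B v = quad B (v - c₀) :=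
    le_antisymm (ciInf_le (bddBelow_quad_sub hB.posSemidef v) ⟨c₀, hc₀⟩)
      (le_ciInf fun c => hmin c c.2)
  rw [e]
  exact ⟨⟨c₀, hc₀, rfl⟩, by rintro _ ⟨c, hc, rfl⟩; exact hmin c hc⟩

lemma continuous_orthantDist (hB : B.PosDef) : Continuous (orthantDist B) := by
  obtain ⟨T, hT⟩ := exists_equiv_dotProduct_mulVec hB
  have e : orthantDist B = fun v => Metric.infDist (T v) (T '' orthant n) ^ 2 := by
    ext v
    obtain ⟨c₀, hc₀, hmin, h⟩ := exists_quad_sub_eq_infDist T hT v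
    rw [← h]
    exact le_antisymm (ciInf_le (bddBelow_quad_sub hB.posSemidef v) ⟨c₀, hc₀⟩)
      (le_ciInf fun c => hmin c c.2)
  rw [e]
  exact ((Metric.continuous_infDist_pt _).comp T.continuous).pow 2

/-- Matrix inversion returns zero on singular matrices, which is the convention of the theorem. -/
lemma posDef_inv_or_inv_eq_zero {A : Matrix (Fin n) (Fin n) ℝ} (hA : A.PosSemidef) :
    A⁻¹.PosDef ∨ A⁻¹ = 0 := by
  by_cases h : IsUnit A.det
  · exact Or.inl ((hA.posDef_iff_det_ne_zero.2 h.ne_zero).inv)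
  · exact Or.inr (Matrix.nonsing_inv_apply_not_isUnit A h)

/-- The orthant is invariant under scaling by `√N > 0`, so the factor `N` moves into the quadratic
form. -/
lemma testStat_eq {N : ℕ} (hN : N ≠ 0) (θ : EuclideanSpace ℝ (Fin n))
    (A : Matrix (Fin n) (Fin n) ℝ) : testStat N θ A = orthantDist A⁻¹ (√N • θ) := by
  have hpos : 0 < √(N : ℝ) := Real.sqrt_pos.2 (by positivity)
  refine Function.Surjective.iInf_congr
    (fun c : orthant n => (⟨√(N : ℝ) • c.1, fun j => mul_nonneg hpos.le (c.2 j)⟩ : orthant n))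
    (fun c => ⟨⟨(√(N : ℝ))⁻¹ • c.1, fun j => mul_nonneg (inv_nonneg.2 hpos.le) (c.2 j)⟩, ?_⟩)
    fun c => ?_
  · ext1
    simp [smul_smul, mul_inv_cancel₀ hpos.ne']
  · rw [← smul_sub, quad_smul, Real.sq_sqrt (Nat.cast_nonneg N)]

lemma isLeast_testStat (N : ℕ) (θ : EuclideanSpace ℝ (Fin n)) {A : Matrix (Fin n) (Fin n) ℝ}
    (hA : A.PosSemidef) :
    IsLeast ((fun c => (N : ℝ) * quad A⁻¹ (θ - c)) '' orthant n) (testStat N θ A) := by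
  have hmin : ∃ c₀ ∈ orthant n, ∀ c ∈ orthant n, quad A⁻¹ (θ - c₀) ≤ quad A⁻¹ (θ - c) := by
    rcases posDef_inv_or_inv_eq_zero hA with h | h
    · obtain ⟨⟨c₀, hc₀, h1⟩, h2⟩ := isLeast_orthantDist h θ
      exact ⟨c₀, hc₀, fun c hc => h1.le.trans (h2 ⟨c, hc, rfl⟩)⟩
    · exact ⟨0, fun _ => le_rfl, fun c _ => by simp [h, quad]⟩
  obtain ⟨c₀, hc₀, hmin⟩ := hmin
  have hmin' : ∀ c ∈ orthant n, (N : ℝ) * quad A⁻¹ (θ - c₀) ≤ N * quad A⁻¹ (θ - c) :=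
    fun c hc => mul_le_mul_of_nonneg_left (hmin c hc) (Nat.cast_nonneg N)
  have hbdd : BddBelow (Set.range fun c : orthant n => (N : ℝ) * quad A⁻¹ (θ - c)) :=
    ⟨_, by rintro _ ⟨c, rfl⟩; exact hmin' c c.2⟩
  have e : testStat N θ A = N * quad A⁻¹ (θ - c₀) :=
    le_antisymm (ciInf_le hbdd ⟨c₀, hc₀⟩) (le_ciInf fun c => hmin' c c.2)
  rw [e]
  exact ⟨⟨c₀, hc₀, rfl⟩, by rintro _ ⟨c, hc, rfl⟩; exact hmin' c hc⟩

/-- By continuity in `c`, the infimum may be taken over a countable dense subset of the orthant. -/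
lemma measurable_testStat {T : Type*} [TopologicalSpace T] [MeasurableSpace T]
    [OpensMeasurableSpace T] (N : ℕ) {θ : T → EuclideanSpace ℝ (Fin n)}
    {A : T → Matrix (Fin n) (Fin n) ℝ} (hθ : Continuous θ) (hA : Continuous A)
    (hpos : ∀ t, (A t).PosSemidef) : Measurable fun t => testStat N (θ t) (A t) := by
  have e : (fun t => testStat N (θ t) (A t)) = fun t => ⨅ k : ℕ, (N : ℝ) * quad (A t)⁻¹
      (θ t - (TopologicalSpace.denseSeq (orthant n) k : EuclideanSpace ℝ (Fin n))) := by
    ext t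
    have hcont : Continuous fun c : orthant n => (N : ℝ) * quad (A t)⁻¹ (θ t - c) :=
      continuous_const.mul ((continuous_quad _).comp (by fun_prop))
    have hbdd : BddBelow (Set.range fun c : orthant n => (N : ℝ) * quad (A t)⁻¹ (θ t - c)) :=
      ⟨0, by
        rintro _ ⟨c, rfl⟩
        exact mul_nonneg (Nat.cast_nonneg N) (quad_nonneg (hpos t).inv _)⟩
    rw [testStat, ← (TopologicalSpace.denseRange_denseSeq (orthant n)).ciInf hcont hbdd]
    exact iInf_range' (fun c : orthant n => (N : ℝ) * quad (A t)⁻¹ (θ t - c)) _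
  rw [e]
  refine Measurable.iInf fun k => Measurable.const_mul ?_ _
  -- Inversion is not continuous at singular matrices; writing it as the inverse determinant times
  -- the adjugate makes it measurable everywhere.
  have e2 : (fun t => quad (A t)⁻¹
      (θ t - (TopologicalSpace.denseSeq (orthant n) k : EuclideanSpace ℝ (Fin n)))) =
      fun t => ((A t).det)⁻¹ * quad (A t).adjugate
        (θ t - (TopologicalSpace.denseSeq (orthant n) k : EuclideanSpace ℝ (Fin n))) := by
    ext t
    rw [quad, quad, Matrix.inv_def, Ring.inverse_eq_inv', Matrix.smul_mulVec, dotProduct_smul,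
      smul_eq_mul]
  rw [e2]
  refine (hA.matrix_det.measurable.inv).mul (Continuous.measurable ?_)
  unfold quad
  have h3 : Continuous fun t => (A t).adjugate := hA.matrix_adjugate
  have h4 : Continuous fun t => (θ t -
    (TopologicalSpace.denseSeq (orthant n) k : EuclideanSpace ℝ (Fin n))).ofLp := by fun_prop
  exact h4.dotProduct (h3.matrix_mulVec h4)

/-- Comparison of the distances to the orthant for two quadratic forms. -/
lemma abs_orthantDist_sub_le {B₀ : Matrix (Fin n) (Fin n) ℝ} (hB : B.PosSemidef)
    (hB₀ : B₀.PosDef) {ε : ℝ} (hε : ∀ x, |quad B x - quad B₀ x| ≤ ε * quad B₀ x)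
    (v : EuclideanSpace ℝ (Fin n)) :
    |orthantDist B v - orthantDist B₀ v| ≤ ε * orthantDist B₀ v := by
  obtain ⟨⟨c₀, hc₀, h1⟩, h2⟩ := isLeast_orthantDist hB₀ v
  have hle : orthantDist B v ≤ quad B (v - c₀) :=
    ciInf_le (bddBelow_quad_sub hB v) ⟨c₀, hc₀⟩
  have hu := (abs_le.1 (hε (v - c₀))).2
  simp only at h1
  have hge : (1 - ε) * orthantDist B₀ v ≤ orthantDist B v := by
    refine le_ciInf fun c => ?_
    have h3 : orthantDist B₀ v ≤ quad B₀ (v - c) := h2 ⟨c, c.2, rfl⟩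
    have h4 : 0 ≤ orthantDist B₀ v := Real.iInf_nonneg fun _ => quad_nonneg hB₀.posSemidef _
    have h5 := (abs_le.1 (hε (v - c))).1
    have h6 := quad_nonneg hB (v - c)
    -- For `ε ≥ 1` the lower bound is trivial, because its left side is nonpositive.
    rcases le_total ε 1 with h | h
    · nlinarith
    · nlinarith
  rw [abs_le]
  constructor
  · linarith
  · rw [h1] at hu
    linarith

lemma orthantDist_le_quad (hB : B.PosSemidef) (v : EuclideanSpace ℝ (Fin n)) :
    orthantDist B v ≤ quad B v := by
  have h := ciInf_le (bddBelow_quad_sub hB v) ⟨0, fun _ => le_rfl⟩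
  rwa [sub_zero] at h

/-- A relative bound: `quad B₀` dominates a multiple of `‖x‖²`, so entrywise closeness of matrices
becomes closeness of forms up to a factor. The constant is the squared norm of the inverse
coordinate change. -/
lemma exists_abs_quad_sub_le {B₀ : Matrix (Fin n) (Fin n) ℝ} (hB₀ : B₀.PosDef) :
    ∃ C : ℝ, 0 ≤ C ∧ ∀ (B : Matrix (Fin n) (Fin n) ℝ) (x : EuclideanSpace ℝ (Fin n)),
      |quad B x - quad B₀ x| ≤ (C * ∑ i, ∑ j, |B i j - B₀ i j|) * quad B₀ x := by
  obtain ⟨T, hT⟩ := exists_equiv_dotProduct_mulVec hB₀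
  set L : EuclideanSpace ℝ (Fin n) →L[ℝ] EuclideanSpace ℝ (Fin n) :=
    (T.symm : EuclideanSpace ℝ (Fin n) →L[ℝ] EuclideanSpace ℝ (Fin n)) with hL
  refine ⟨‖L‖ ^ 2, by positivity, fun B x => ?_⟩
  have hx : ‖x‖ ^ 2 ≤ ‖L‖ ^ 2 * quad B₀ x := by
    rw [quad, hT, real_inner_self_eq_norm_sq, ← mul_pow]
    refine pow_le_pow_left₀ (norm_nonneg _) ?_ 2
    simpa [hL] using L.le_opNorm (T x)
  have hcoord : ∀ i, |x i| ≤ ‖x‖ := fun i => by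
    simpa using PiLp.norm_apply_le (p := 2) x i
  have e : quad B x - quad B₀ x = ∑ i, ∑ j, x i * ((B i j - B₀ i j) * x j) := by
    simp only [quad, dotProduct, Matrix.mulVec, Finset.mul_sum, ← Finset.sum_sub_distrib]
    refine Finset.sum_congr rfl fun i _ => Finset.sum_congr rfl fun j _ => ?_
    ring
  rw [e]
  calc _ ≤ ∑ i, ∑ j, |x i * ((B i j - B₀ i j) * x j)| :=
        (Finset.abs_sum_le_sum_abs _ _).trans
          (Finset.sum_le_sum fun i _ => Finset.abs_sum_le_sum_abs _ _)
    _ ≤ ∑ i, ∑ j, ‖x‖ * (|B i j - B₀ i j| * ‖x‖) := by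
        refine Finset.sum_le_sum fun i _ => Finset.sum_le_sum fun j _ => ?_
        rw [abs_mul, abs_mul]
        have hi := hcoord i
        have hj := hcoord j
        gcongr
    _ = (∑ i, ∑ j, |B i j - B₀ i j|) * ‖x‖ ^ 2 := by
        simp only [Finset.sum_mul]
        refine Finset.sum_congr rfl fun i _ => Finset.sum_congr rfl fun j _ => ?_
        ring
    _ ≤ (∑ i, ∑ j, |B i j - B₀ i j|) * (‖L‖ ^ 2 * quad B₀ x) := by
        gcongr
    _ = _ := by ring

/-- Moreau's decomposition: the chi-bar-squared statistic of the polar cone of the orthant is the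
squared distance to the orthant. -/
lemma chiBarStat_polarCone {V : Matrix (Fin n) (Fin n) ℝ} (hV : V.PosDef)
    (z : EuclideanSpace ℝ (Fin n)) :
    chiBarStat V (polarCone V (orthant n)) z = orthantDist V⁻¹ z := by
  obtain ⟨T, hT⟩ := exists_equiv_dotProduct_mulVec hV.inv
  obtain ⟨⟨p, hp, hpe⟩, hle⟩ := isLeast_orthantDist hV.inv z
  simp only at hpe
  have hq : ∀ v, quad V⁻¹ v = inner ℝ (T v) (T v) := fun v => hT v v
  -- Minimality of the nearest point `p`, tested at a displacement that remains in the orthant.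
  have hvar : ∀ c : EuclideanSpace ℝ (Fin n), ∀ t : ℝ, p + t • c ∈ orthant n →
      0 ≤ t ^ 2 * inner ℝ (T c) (T c) - 2 * t * inner ℝ (T (z - p)) (T c) := by
    intro c t hc
    have h1 := hle ⟨_, hc, rfl⟩
    simp only at h1
    rw [← hpe, hq, hq, ← sub_sub, map_sub T (z - p), map_smul, inner_sub_left, inner_sub_right,
      inner_sub_right, inner_smul_left, inner_smul_right, inner_smul_left, inner_smul_right,
      real_inner_comm (T c) (T (z - p))] at h1
    simp only [RCLike.conj_to_real] at h1
    rw [real_inner_comm (T c) (T (z - p))]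
    nlinarith
  have hpolar : ∀ c ∈ orthant n, inner ℝ (T (z - p)) (T c) ≤ 0 := by
    intro c hc
    by_contra! hcon
    have hcc : 0 ≤ inner ℝ (T c) (T c) := real_inner_self_nonneg
    set b := inner ℝ (T (z - p)) (T c)
    set a := inner ℝ (T c) (T c)
    have ht : 0 < b / (a + 1) := by positivity
    -- The quadratic in `t` is negative for `0 < t < 2b/a`; `b / (a + 1)` is such a `t` and is
    -- defined also when `a = 0`.
    have h1 := hvar c (b / (a + 1)) fun j => by
      have := hp j
      have := hc j
      simp only [PiLp.add_apply, PiLp.smul_apply, smul_eq_mul]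
      positivity
    have h2 : (b / (a + 1)) ^ 2 * a - 2 * (b / (a + 1)) * b =
        (b / (a + 1)) * (b * (a / (a + 1) - 2)) := by ring
    rw [h2] at h1
    have h3 : a / (a + 1) < 1 := by rw [div_lt_one (by positivity)]; linarith
    have h4 : b * (a / (a + 1) - 2) < 0 := mul_neg_of_pos_of_neg hcon (by linarith)
    nlinarith [mul_neg_of_pos_of_neg ht h4]
  have horth : inner ℝ (T (z - p)) (T p) = 0 := by
    refine le_antisymm (hpolar p hp) ?_
    by_contra! hcon
    have hcc : 0 ≤ inner ℝ (T p) (T p) := real_inner_self_nonneg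
    set b := inner ℝ (T (z - p)) (T p)
    set a := inner ℝ (T p) (T p)
    -- Shrinking `p` to `(1 - τ) p` remains in the orthant for `τ ≤ 1`; the second bound makes the
    -- variation negative.
    set τ := min 1 (-b / (a + 1)) with hτ
    have hτ0 : 0 < τ := lt_min one_pos (div_pos (by linarith) (by positivity))
    have h1 := hvar p (-τ) fun j => by
      have h := hp j
      simp only [PiLp.add_apply, PiLp.smul_apply, smul_eq_mul]
      nlinarith [min_le_left 1 (-b / (a + 1))]
    have h2 : τ * (a + 1) ≤ -b := by
      have := min_le_right 1 (-b / (a + 1))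
      rwa [← hτ, le_div_iff₀ (by positivity)] at this
    nlinarith [mul_pos hτ0 hτ0]
  have hmem : z - p ∈ polarCone V (orthant n) := fun c hc => by rw [hT]; exact hpolar c hc
  -- The residual `z - p` is the nearest point of the polar cone to `z`, at the distance given by
  -- `p`: for `x` in the polar cone, `⟪T x, T p⟫ ≤ 0` and `⟪T (z - p), T p⟫ = 0`.
  have hinf : ⨅ x : polarCone V (orthant n), quad V⁻¹ (z - x) = quad V⁻¹ p := by
    have hlow : ∀ x ∈ polarCone V (orthant n), quad V⁻¹ p ≤ quad V⁻¹ (z - x) := by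
      intro x hx
      have h1 : inner ℝ (T x) (T p) ≤ 0 := by rw [← hT]; exact hx p hp
      have e : T (z - x) = T p + (T (z - p) - T x) := by simp only [map_sub]; abel
      rw [hq, hq, e, inner_add_left, inner_add_right, inner_add_right,
        real_inner_comm (T (z - p) - T x) (T p)]
      have h2 : inner ℝ (T (z - p) - T x) (T p) = - inner ℝ (T x) (T p) := by
        rw [inner_sub_left, horth]; ring
      have h3 : 0 ≤ inner ℝ (T (z - p) - T x) (T (z - p) - T x) := real_inner_self_nonneg
      have h4 : inner ℝ (T p) (T (z - p) - T x) = - inner ℝ (T x) (T p) := by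
        rw [real_inner_comm, h2]
      linarith
    have : Nonempty (polarCone V (orthant n)) := ⟨⟨_, hmem⟩⟩
    refine le_antisymm ?_ (le_ciInf fun x => hlow x x.2)
    have := ciInf_le (f := fun x : polarCone V (orthant n) => quad V⁻¹ (z - x))
      ⟨quad V⁻¹ p, by rintro _ ⟨x, rfl⟩; exact hlow x x.2⟩ ⟨_, hmem⟩
    simpa using this
  rw [chiBarStat, hinf, ← hpe, hq, hq, hq]
  have e : T z = T (z - p) + T p := by simp
  rw [e, inner_add_left, inner_add_right, inner_add_right, horth,
    real_inner_comm (T (z - p)) (T p), horth]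
  ring

lemma chiBarStat_orthant (V : Matrix (Fin n) (Fin n) ℝ) (z : EuclideanSpace ℝ (Fin n)) :
    chiBarStat V (orthant n) z = quad V⁻¹ z - orthantDist V⁻¹ z := rfl

lemma measurable_chiBarStat_polarCone {V : Matrix (Fin n) (Fin n) ℝ} (hV : V.PosDef) :
    Measurable (chiBarStat V (polarCone V (orthant n))) := by
  have : chiBarStat V (polarCone V (orthant n)) = orthantDist V⁻¹ :=
    funext (chiBarStat_polarCone hV)
  rw [this]
  exact (continuous_orthantDist hV.inv).measurable

lemma measurable_chiBarStat_orthant {V : Matrix (Fin n) (Fin n) ℝ} (hV : V.PosDef) :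
    Measurable (chiBarStat V (orthant n)) :=
  ((continuous_quad _).sub (continuous_orthantDist hV.inv)).measurable

open scoped MatrixOrder Matrix in
/-- `Zᵀ V⁻¹ Z` is chi-squared distributed for `Z ∼ N(0, V)`. -/
lemma hasLaw_quad_inv {V : Matrix (Fin n) (Fin n) ℝ} (hV : V.PosDef) :
    HasLaw (quad V⁻¹) (chiSq n) (multivariateGaussian 0 V) := by
  refine ⟨(continuous_quad _).measurable.aemeasurable, ?_⟩
  set R := CFC.sqrt V with hR
  have hRR : R * R = V := CFC.sqrt_mul_sqrt_self _ hV.posSemidef.nonneg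
  have hRu : IsUnit R := isUnit_of_mul_isUnit_left (hRR ▸ hV.isUnit)
  have hdet : IsUnit R.det := (Matrix.isUnit_iff_isUnit_det R).1 hRu
  have hsa : R.transpose = R := by
    have := (CFC.sqrt_nonneg V).isSelfAdjoint
    rw [isSelfAdjoint_iff, Matrix.star_eq_conjTranspose] at this
    simpa using this
  -- `Z` has the law of `V^{1/2} X` with `X` standard normal, so this identity turns the form into
  -- `‖X‖²`.
  have hinv : R * V⁻¹ * R = 1 := by
    rw [← hRR, Matrix.mul_inv_rev, ← mul_assoc, Matrix.mul_nonsing_inv _ hdet, one_mul,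
      Matrix.nonsing_inv_mul _ hdet]
  rw [multivariateGaussian, ← map_pi_eq_stdGaussian,
    Measure.map_map (continuous_quad _).measurable (by fun_prop),
    Measure.map_map ((continuous_quad _).measurable.comp (by fun_prop)) (by fun_prop), chiSq]
  congr 1
  ext x
  simp only [Function.comp_apply, zero_add, Matrix.toEuclideanCLM_toLp, quad, ← hR]
  have e : R.mulVec x = x ᵥ* R := by rw [← Matrix.mulVec_transpose, hsa]
  rw [Matrix.mulVec_mulVec]
  nth_rewrite 1 [e]
  rw [← Matrix.dotProduct_mulVec, Matrix.mulVec_mulVec, ← mul_assoc, hinv, Matrix.one_mulVec]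
  simp [dotProduct, sq]

end Cone

/-! ### Limit theorems -/

section Limit

variable {Ω : Type*} [MeasurableSpace Ω] {Pr : Measure Ω}

/-- The Cramér–Wold device: the frequency `t` of a vector is the frequency 1 of its projection on
`t`. -/
lemma charFun_map_eq_charFun_map_inner {E : Type*} [NormedAddCommGroup E] [InnerProductSpace ℝ E]
    [MeasurableSpace E] [BorelSpace E] [SecondCountableTopology E] {V : Ω → E}
    (hV : AEMeasurable V Pr) (t : E) :
    charFun (Pr.map V) t = charFun (Pr.map fun ω => inner ℝ (V ω) t) 1 := by
  have hVt : AEMeasurable (fun ω => inner ℝ (V ω) t) Pr := by fun_prop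
  rw [charFun_apply, charFun_apply, integral_map hV (by fun_prop), integral_map hVt (by fun_prop)]
  simp

variable [IsProbabilityMeasure Pr]

/-- The multivariate central limit theorem. -/
lemma tendstoInDistribution_inv_sqrt_smul_sum {n : ℕ}
    {V : ℕ → Ω → EuclideanSpace ℝ (Fin n)} {S : Matrix (Fin n) (Fin n) ℝ} (hS : S.PosSemidef)
    (hindep : iIndepFun V Pr) (hident : ∀ i, IdentDistrib (V i) (V 0) Pr Pr)
    (hL2 : MemLp (V 0) 2 Pr) (hmean : ∫ ω, V 0 ω ∂Pr = 0)
    (hcov : ∀ t, ∫ ω, inner ℝ (V 0 ω) t ^ 2 ∂Pr = t.ofLp ⬝ᵥ S.mulVec t.ofLp) :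
    TendstoInDistribution (fun (N : ℕ) ω => (√N)⁻¹ • ∑ i ∈ Finset.range N, V i ω) atTop id
      (fun _ => Pr) (multivariateGaussian 0 S) where
  forall_aemeasurable N :=
    AEMeasurable.fun_const_smul
      (Finset.aemeasurable_fun_sum _ fun i _ => (hident i).aemeasurable_fst) _
  tendsto := by
    refine ProbabilityMeasure.tendsto_iff_tendsto_charFun.2 fun t => ?_
    have hm (i : ℕ) : AEMeasurable (V i) Pr := (hident i).aemeasurable_fst
    have hmeas : Measurable fun v : EuclideanSpace ℝ (Fin n) => inner ℝ v t := by fun_prop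
    have hm0 : ∫ ω, inner ℝ (V 0 ω) t ∂Pr = 0 := by
      simp_rw [real_inner_comm t]
      rw [integral_inner (hL2.integrable (by norm_num)), hmean, inner_zero_right]
    have hvar : variance (fun ω => inner ℝ (V 0 ω) t) Pr = t.ofLp ⬝ᵥ S.mulVec t.ofLp := by
      have h : AEMeasurable (fun ω => inner ℝ (V 0 ω) t) Pr := hmeas.comp_aemeasurable (hm 0)
      rw [variance_eq_integral h, hm0, ← hcov t]
      simp
    -- The scalar central limit theorem for the projections on `t`; its characteristic function at 1
    -- is the one required at `t`.
    have hclt := tendstoInDistribution_inv_sqrt_mul_sum_sub (P := Pr)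
      (X := fun i ω => inner ℝ (V i ω) t) (Y := id)
      (P' := gaussianReal 0 (variance (fun ω => inner ℝ (V 0 ω) t) Pr).toNNReal)
      HasLaw.id (hL2.inner_const t) (hindep.comp (fun _ v => inner ℝ v t) fun _ => hmeas)
      (fun i => (hident i).comp hmeas)
    have h1 := ProbabilityMeasure.tendsto_iff_tendsto_charFun.1 hclt.tendsto 1
    simp only [ProbabilityMeasure.coe_mk, Measure.map_id] at h1 ⊢
    rw [charFun_gaussianReal] at h1
    rw [charFun_multivariateGaussian hS]
    refine Tendsto.congr (fun N => ?_) (h1.trans_eq ?_)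
    · rw [charFun_map_eq_charFun_map_inner
        (AEMeasurable.fun_const_smul (Finset.aemeasurable_fun_sum _ fun i _ => hm i) _)]
      congr 2
      ext ω
      rw [hm0, inner_smul_left, sum_inner]
      simp
    · rw [hvar, Real.coe_toNNReal _ (by simpa using hS.dotProduct_mulVec_nonneg t.ofLp)]
      simp

/-- The second moment of a normalized sum of centred independent vectors. -/
lemma integral_norm_sqrt_smul_avg_sq {H : Type*} [NormedAddCommGroup H] [InnerProductSpace ℝ H]
    [CompleteSpace H] [MeasurableSpace H] [BorelSpace H] {V : ℕ → Ω → H}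
    (hindep : Pairwise fun i j => IndepFun (V i) (V j) Pr)
    (hident : ∀ i, IdentDistrib (V i) (V 0) Pr Pr) (hL2 : MemLp (V 0) 2 Pr)
    (hmean : ∫ ω, V 0 ω ∂Pr = 0) (N : ℕ) :
    Integrable (fun ω => ‖√N • avg N fun i => V i ω‖ ^ 2) Pr ∧
      ∫ ω, ‖√N • avg N fun i => V i ω‖ ^ 2 ∂Pr ≤ ∫ ω, ‖V 0 ω‖ ^ 2 ∂Pr := by
  have hL (i : ℕ) : MemLp (V i) 2 Pr := (hident i).memLp_iff.2 hL2
  have hint (i : ℕ) : Integrable (V i) Pr := (hL i).integrable (by norm_num)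
  have hinner (i j : ℕ) : Integrable (fun ω => inner ℝ (V i ω) (V j ω)) Pr := by
    refine ((hL i).norm.integrable_mul (hL j).norm).mono ((hL i).1.inner (hL j).1)
      (ae_of_all _ fun ω => ?_)
    simpa using abs_real_inner_le_norm (V i ω) (V j ω)
  -- Independence factors the expectation of the inner product, and both means vanish; only the
  -- diagonal survives.
  have hoff (i j : ℕ) (hij : i ≠ j) : ∫ ω, inner ℝ (V i ω) (V j ω) ∂Pr = 0 := by
    have := (hindep hij).integral_bilin (hint i) (hint j) (innerSL ℝ)
    rw [(hident i).integral_eq, hmean, map_zero, zero_apply] at this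
    exact this
  have hdiag (i : ℕ) : ∫ ω, inner ℝ (V i ω) (V i ω) ∂Pr = ∫ ω, ‖V 0 ω‖ ^ 2 ∂Pr := by
    simp_rw [real_inner_self_eq_norm_sq]
    exact ((hident i).comp (u := fun v : H => ‖v‖ ^ 2) (by fun_prop)).integral_eq
  have e : (fun ω => ‖√N • avg N fun i => V i ω‖ ^ 2) = fun ω =>
      (√N * (N : ℝ)⁻¹) ^ 2 *
        ∑ i ∈ Finset.range N, ∑ j ∈ Finset.range N, inner ℝ (V i ω) (V j ω) := by
    ext ω
    rw [avg, smul_smul, norm_smul, mul_pow, Real.norm_eq_abs, sq_abs,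
      ← real_inner_self_eq_norm_sq, sum_inner]
    simp_rw [inner_sum]
  have hsum : Integrable (fun ω => ∑ i ∈ Finset.range N, ∑ j ∈ Finset.range N,
      inner ℝ (V i ω) (V j ω)) Pr :=
    integrable_finsetSum _ fun i _ => integrable_finsetSum _ fun j _ => hinner i j
  rw [e]
  refine ⟨hsum.const_mul _, ?_⟩
  rw [integral_const_mul,
    integral_finsetSum _ fun i _ => integrable_finsetSum _ fun j _ => hinner i j]
  have e2 : ∑ i ∈ Finset.range N, ∫ ω, ∑ j ∈ Finset.range N, inner ℝ (V i ω) (V j ω) ∂Pr =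
      N * ∫ ω, ‖V 0 ω‖ ^ 2 ∂Pr := by
    have : ∀ i ∈ Finset.range N, ∫ ω, ∑ j ∈ Finset.range N, inner ℝ (V i ω) (V j ω) ∂Pr =
        ∫ ω, ‖V 0 ω‖ ^ 2 ∂Pr := by
      intro i hi
      rw [integral_finsetSum _ fun j _ => hinner i j, Finset.sum_eq_single_of_mem i hi
        fun j _ hj => hoff i j hj.symm, hdiag]
    rw [Finset.sum_congr rfl this]
    simp
  rw [e2, mul_pow, Real.sq_sqrt (Nat.cast_nonneg N)]
  have h0 : 0 ≤ ∫ ω, ‖V 0 ω‖ ^ 2 ∂Pr := integral_nonneg fun _ => by positivity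
  rcases eq_or_ne N 0 with rfl | hN
  · simpa using h0
  · have : (N : ℝ) ≠ 0 := Nat.cast_ne_zero.2 hN
    refine le_of_eq ?_
    field_simp

/-- Vectors dominated by the product of an `L²`-bounded sequence and a sequence that tends to zero
almost surely tend to zero in measure. -/
lemma tendstoInMeasure_zero_of_norm_le_mul {E : Type*} [NormedAddCommGroup E] {r : ℕ → Ω → E}
    {X a : ℕ → Ω → ℝ} {C : ℝ} (hXint : ∀ N, Integrable (fun ω => X N ω ^ 2) Pr)
    (hXC : ∀ N, ∫ ω, X N ω ^ 2 ∂Pr ≤ C) (ham : ∀ N, AEStronglyMeasurable (a N) Pr)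
    (ha : ∀ᵐ ω ∂Pr, Tendsto (fun N => a N ω) atTop (𝓝 0))
    (hr : ∀ᶠ N in atTop, ∀ ω, ‖r N ω‖ ≤ |X N ω| * |a N ω|) :
    TendstoInMeasure Pr r atTop fun _ => 0 := by
  rw [tendstoInMeasure_iff_measureReal_norm]
  intro ε hε
  have hC : 0 ≤ C := (integral_nonneg fun _ => sq_nonneg _).trans (hXC 0)
  rw [Metric.tendsto_nhds]
  intro η hη
  -- With this level Markov's inequality bounds the probability of `|X N| ≥ K` by `C / K² < η / 2`;
  -- adding 1 to `C` keeps `K` positive and the inequality strict.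
  set K : ℝ := √(2 * (C + 1) / η) with hK
  have hKpos : 0 < K := by positivity
  have hK2 : K ^ 2 = 2 * (C + 1) / η := Real.sq_sqrt (by positivity)
  have hmeas := (tendstoInMeasure_iff_measureReal_norm.1
    (tendstoInMeasure_of_tendsto_ae ham ha)) (ε / K) (by positivity)
  filter_upwards [hr, hmeas.eventually_lt_const (half_pos hη)] with N hN hsmall
  simp only [sub_zero, Real.norm_eq_abs] at hsmall ⊢
  have hmarkov := mul_meas_ge_le_integral_of_nonneg
    (ae_of_all Pr fun ω => sq_nonneg (X N ω)) (hXint N) (K ^ 2)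
  have hbig : Pr.real {ω | K ^ 2 ≤ X N ω ^ 2} < η / 2 := by
    have h1 : K ^ 2 * Pr.real {ω | K ^ 2 ≤ X N ω ^ 2} < K ^ 2 * (η / 2) := by
      have : K ^ 2 * (η / 2) = C + 1 := by rw [hK2]; field_simp
      linarith [hXC N]
    exact lt_of_mul_lt_mul_left h1 (by positivity)
  have hsub : {ω | ε ≤ ‖r N ω‖} ⊆ {ω | K ^ 2 ≤ X N ω ^ 2} ∪ {ω | ε / K ≤ |a N ω|} := by
    intro ω hω
    by_contra hcon
    simp only [Set.mem_union, Set.mem_ofPred_eq, not_or, not_le] at hcon hω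
    have h1 : |X N ω| < K := by
      rw [← abs_of_pos hKpos]
      exact sq_lt_sq.1 hcon.1
    have h2 : |X N ω| * |a N ω| < K * (ε / K) :=
      mul_lt_mul'' h1 hcon.2 (abs_nonneg _) (abs_nonneg _)
    have h3 : K * (ε / K) = ε := by field_simp
    linarith [hN ω]
  have := (measureReal_mono (μ := Pr) hsub).trans (measureReal_union_le _ _)
  rw [Real.dist_eq, sub_zero, abs_of_nonneg measureReal_nonneg]
  linarith

end Limit

/-! ### Asymptotics of the sample statistics -/

section Asymptotics

variable {H : Type*} [NormedAddCommGroup H] [InnerProductSpace ℝ H]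

/-- The vector of inner products of the sample minimizer with `φ_j`. -/
def sampleTheta (lam : ℝ) {n : ℕ} (φ : Fin n → H) (N : ℕ) (x : ℕ → H) :
    EuclideanSpace ℝ (Fin n) :=
  WithLp.toLp 2 fun j => inner ℝ (φ j) (sampleMin lam N x)

/-- The sample version of the matrix `Ω`. -/
def sampleOmega (lam : ℝ) {n : ℕ} (φ : Fin n → H) (N : ℕ) (x : ℕ → H) :
    Matrix (Fin n) (Fin n) ℝ :=
  Matrix.of fun k j =>
    inner ℝ (sampleRes lam N x (φ k)) (sampleQ lam N x (sampleRes lam N x (φ j)))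

variable {n : ℕ} {φ : Fin n → H} {lam : ℝ}

lemma posSemidef_sampleOmega (N : ℕ) (x : ℕ → H) : (sampleOmega lam φ N x).PosSemidef := by
  refine Matrix.PosSemidef.of_dotProduct_mulVec_nonneg ?_ fun t => ?_
  · ext k j
    simp only [sampleOmega, Matrix.conjTranspose_apply, Matrix.of_apply, star_trivial]
    rw [sampleQ, ← inner_avg_rankOne_comm, real_inner_comm]
  · have e : star t ⬝ᵥ (sampleOmega lam φ N x).mulVec t =
        inner ℝ (sampleQ lam N x (∑ j, t j • sampleRes lam N x (φ j)))
          (∑ j, t j • sampleRes lam N x (φ j)) := by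
      rw [real_inner_comm, sum_inner]
      simp only [dotProduct, Matrix.mulVec, sampleOmega, Matrix.of_apply, map_sum, map_smul,
        inner_sum, inner_smul_left, inner_smul_right, star_trivial, Pi.star_apply,
        RCLike.conj_to_real]
      refine Finset.sum_congr rfl fun k _ => ?_
      rw [Finset.mul_sum]
      refine Finset.sum_congr rfl fun j _ => ?_
      ring
    rw [e]
    exact inner_avg_rankOne_nonneg _ _ _

lemma norm_euclideanSpace_le_sum (v : EuclideanSpace ℝ (Fin n)) : ‖v‖ ≤ ∑ j, |v j| := by
  conv_lhs => rw [← (EuclideanSpace.basisFun (Fin n) ℝ).sum_repr v]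
  refine (norm_sum_le _ _).trans (Finset.sum_le_sum fun j _ => ?_)
  simp [norm_smul]

/-- The linear map `v ↦ (⟪u_j, v⟫)_j`. -/
def innerVec (u : Fin n → H) : H →L[ℝ] EuclideanSpace ℝ (Fin n) :=
  ((EuclideanSpace.equiv (Fin n) ℝ).symm : (Fin n → ℝ) →L[ℝ] EuclideanSpace ℝ (Fin n)).comp
    (ContinuousLinearMap.pi fun j => innerSL ℝ (u j))

lemma innerVec_apply (u : Fin n → H) (v : H) (j : Fin n) : innerVec u v j = inner ℝ (u j) v := rfl

lemma inner_innerVec (u : Fin n → H) (v : H) (t : EuclideanSpace ℝ (Fin n)) :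
    inner ℝ (innerVec u v) t = inner ℝ v (∑ j, t j • u j) := by
  rw [PiLp.inner_apply, inner_sum]
  refine Finset.sum_congr rfl fun j _ => ?_
  rw [innerVec_apply, inner_smul_right, real_inner_comm (u j) v]
  simp

variable [CompleteSpace H]

lemma continuous_sampleTheta (hlam : 0 < lam) (N : ℕ) : Continuous (sampleTheta lam φ N) := by
  have h := continuous_sampleMin (H := H) hlam N
  unfold sampleTheta
  fun_prop

lemma continuous_sampleOmega (hlam : 0 < lam) (N : ℕ) : Continuous (sampleOmega lam φ N) := by
  have h1 := continuous_sampleRes (H := H) hlam N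
  have h2 := continuous_sampleQ (H := H) hlam N
  refine continuous_matrix fun k j => ?_
  exact (h1.clm_apply continuous_const).inner (h2.clm_apply (h1.clm_apply continuous_const))

/-- The error of the linearization of the sample vector. -/
lemma norm_sqrt_smul_sampleTheta_sub_le (hlam : 0 < lam) {N : ℕ} (hN : N ≠ 0) (x : ℕ → H)
    {m h : H}
    {S : H →L[ℝ] H} (hh : S h + lam • h = m) (hφ : ∀ j, inner ℝ (φ j) h = 0) (u : Fin n → H) :
    ‖√N • sampleTheta lam φ N x - √N • innerVec u (avg N fun i => fluct m S h (x i))‖ ≤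
      (‖√N • avg N (fun i => fluct m S h (x i))‖ + ‖√N • avg N (fun i => x i - m)‖) *
        ∑ j, (‖sampleRes lam N x (φ j) - u j‖ + ‖h‖ * ‖avg N x - m‖ * ‖sampleRes lam N x (φ j)‖) := by
  set A := avg N fun i => fluct m S h (x i)
  have hδ : avg N (fun i => x i - m) = avg N x - m := by rw [avg_sub, avg_const hN]
  rw [hδ]
  set δ := avg N x - m
  refine (norm_euclideanSpace_le_sum _).trans ?_
  rw [Finset.mul_sum]
  refine Finset.sum_le_sum fun j _ => ?_
  set v := sampleRes lam N x (φ j)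
  -- Self-adjointness moves the resolvent onto `φ_j`, and `⟪φ_j, h⟫ = 0` removes the centring term.
  -- What remains is a factor bounded in `L²` times one that tends to zero, as
  -- `tendstoInMeasure_zero_of_norm_le_mul` requires.
  have e1 : inner ℝ (φ j) (sampleMin lam N x) = inner ℝ v A + inner ℝ δ h * inner ℝ v δ := by
    have : sampleMin lam N x = h + (sampleMin lam N x - h) := by abel
    rw [this, inner_add_right, hφ, sampleMin_sub_eq hlam hN x hh, ← inner_sampleRes_comm hlam,
      inner_add_right, inner_smul_right, zero_add]
  have e : (√N • sampleTheta lam φ N x - √N • innerVec u A) j =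
      inner ℝ (v - u j) (√N • A) + inner ℝ δ h * inner ℝ v (√N • δ) := by
    simp only [PiLp.sub_apply, PiLp.smul_apply, innerVec_apply, smul_eq_mul, sampleTheta, e1,
      inner_sub_left, inner_smul_right]
    ring
  rw [e]
  have b1 : |inner ℝ (v - u j) (√N • A)| ≤ ‖v - u j‖ * ‖√N • A‖ := abs_real_inner_le_norm _ _
  have b2 : |inner ℝ δ h * inner ℝ v (√N • δ)| ≤ (‖δ‖ * ‖h‖) * (‖v‖ * ‖√N • δ‖) := by
    rw [abs_mul]
    gcongr <;> exact abs_real_inner_le_norm _ _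
  refine (abs_add_le _ _).trans ((add_le_add b1 b2).trans ?_)
  have p1 : 0 ≤ ‖√N • A‖ * (‖h‖ * ‖δ‖ * ‖v‖) := by positivity
  have p2 : 0 ≤ ‖√N • δ‖ * ‖v - u j‖ := by positivity
  nlinarith

end Asymptotics

/-! ### Strong law and moment transfer for functions of the features. -/

section Probability

variable {H : Type*} [NormedAddCommGroup H] [MeasurableSpace H] [BorelSpace H] {Ω : Type*}
  [MeasurableSpace Ω] {Pr : Measure Ω}

/-- The strong law of large numbers for continuous functions of an i.i.d. sequence. -/
lemma ae_tendsto_avg {F : Type*} [NormedAddCommGroup F] [NormedSpace ℝ F] [CompleteSpace F]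
    {x : ℕ → Ω → H}
    (hindep : iIndepFun x Pr) (hident : ∀ i, IdentDistrib (x i) (x 0) Pr Pr) {g : H → F}
    (hg : Continuous g) (hint : Integrable (fun ω => g (x 0 ω)) Pr) :
    ∀ᵐ ω ∂Pr, Tendsto (fun N => avg N fun i => g (x i ω)) atTop (𝓝 (∫ ω, g (x 0 ω) ∂Pr)) := by
  borelize F
  exact strong_law_ae (fun i ω => g (x i ω)) hint
    (fun i j hij => (hindep.indepFun hij).comp hg.measurable hg.measurable)
    fun i => (hident i).comp hg.measurable

lemma memLp_two_of_norm_le [SecondCountableTopology H] {V : Ω → H} {f : H → H}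
    (hV : AEMeasurable V Pr) (hf : Continuous f)
    (h4 : Integrable (fun ω => (1 + ‖V ω‖) ^ 4) Pr) {c : ℝ}
    (hc : ∀ v, ‖f v‖ ≤ c * (1 + ‖v‖) ^ 2) : MemLp (fun ω => f (V ω)) 2 Pr := by
  have hm : AEStronglyMeasurable (fun ω => f (V ω)) Pr :=
    hf.comp_aestronglyMeasurable hV.aestronglyMeasurable
  rw [memLp_two_iff_integrable_sq_norm hm]
  refine (h4.const_mul (c ^ 2)).mono (hm.norm.pow 2) (ae_of_all _ fun ω => ?_)
  rw [Real.norm_of_nonneg (by positivity), Real.norm_of_nonneg (by positivity)]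
  calc _ ≤ (c * (1 + ‖V ω‖) ^ 2) ^ 2 := pow_le_pow_left₀ (norm_nonneg _) (hc _) 2
    _ = _ := by ring

end Probability

section Asymptotics

lemma norm_sub_le_mul_sq {E : Type*} [NormedAddCommGroup E] (m v : E) :
    ‖v - m‖ ≤ (1 + ‖m‖) * (1 + ‖v‖) ^ 2 := by
  have h1 := norm_nonneg v
  have h2 := norm_nonneg m
  refine (norm_sub_le _ _).trans ?_
  nlinarith [mul_nonneg h1 h2, mul_nonneg h2 (sq_nonneg ‖v‖)]

variable {H : Type*} [NormedAddCommGroup H] [InnerProductSpace ℝ H] [CompleteSpace H]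
  {Ω : Type*} [MeasurableSpace Ω]
  {Pr : Measure Ω} [IsProbabilityMeasure Pr] {x : ℕ → Ω → H} {lam : ℝ} {m h : H} {S : H →L[ℝ] H}

/-- Both parts are centred because `m` and `S` are the exact mean and covariance; `h` is arbitrary.
-/
lemma integral_fluct_eq_zero (hL2 : MemLp (x 0) 2 Pr) (hm : m = ∫ ω, x 0 ω ∂Pr)
    (hS : S = ∫ ω, InnerProductSpace.rankOne ℝ (x 0 ω - m) (x 0 ω - m) ∂Pr) (h : H) :
    ∫ ω, fluct m S h (x 0 ω) ∂Pr = 0 := by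
  have hx := hL2.integrable (by norm_num)
  have hT := integrable_rankOne_self (hL2.sub (memLp_const m))
  simp only [Pi.sub_apply] at hT
  have hTS := hT.sub (integrable_const S)
  have e1 : ∫ ω, (x 0 ω - m) ∂Pr = 0 := by
    rw [integral_sub hx (integrable_const m), integral_const, ← hm]
    simp
  have e2 : ∫ ω, (InnerProductSpace.rankOne ℝ (x 0 ω - m) (x 0 ω - m) - S) h ∂Pr = 0 := by
    have := ContinuousLinearMap.integral_apply hTS h
    simp only [Pi.sub_apply] at this
    rw [← this, integral_sub hT (integrable_const S), ← hS]
    simp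
  simp only [fluct]
  have e3 := integral_sub (hx.sub (integrable_const m)) (hTS.apply_continuousLinearMap h)
  simp only [Pi.sub_apply] at e3
  rw [e3, e1, e2, sub_zero]

variable [SecondCountableTopology H] [MeasurableSpace H] [BorelSpace H]

/-- Consistency of the sample mean, resolvent and operator `Q`. -/
lemma ae_tendsto_sample (hlam : 0 < lam) (hindep : iIndepFun x Pr)
    (hident : ∀ i, IdentDistrib (x i) (x 0) Pr Pr)
    (h4 : Integrable (fun ω => (1 + ‖x 0 ω‖) ^ 4) Pr) (hm : m = ∫ ω, x 0 ω ∂Pr)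
    (hS : S = ∫ ω, InnerProductSpace.rankOne ℝ (x 0 ω - m) (x 0 ω - m) ∂Pr)
    (hh : h = Ring.inverse (S + lam • (1 : H →L[ℝ] H)) m) :
    ∀ᵐ ω ∂Pr, Tendsto (fun N => avg N fun i => x i ω) atTop (𝓝 m) ∧
      Tendsto (fun N => sampleRes lam N fun i => x i ω) atTop
        (𝓝 (Ring.inverse (S + lam • (1 : H →L[ℝ] H)))) ∧
      Tendsto (fun N => sampleQ lam N fun i => x i ω) atTop
        (𝓝 (∫ ω, InnerProductSpace.rankOne ℝ (fluct m S h (x 0 ω)) (fluct m S h (x 0 ω)) ∂Pr)) := by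
  have hx : AEMeasurable (x 0) Pr := (hident 0).aemeasurable_fst
  have hS0 : ∀ u, 0 ≤ inner ℝ (S u) u := by
    rw [hS]
    exact inner_integral_rankOne_self_nonneg _ _
  have l0 : MemLp (fun ω => x 0 ω) 2 Pr :=
    memLp_two_of_norm_le (f := id) hx continuous_id h4 (c := 1)
      fun v => by simpa using norm_sub_le_mul_sq 0 v
  have l1 : MemLp (fun ω => x 0 ω - m) 2 Pr :=
    memLp_two_of_norm_le (f := fun v => v - m) hx (by fun_prop) h4 (norm_sub_le_mul_sq m)
  have l2 : MemLp (fun ω => fluct m S h (x 0 ω)) 2 Pr :=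
    memLp_two_of_norm_le hx (continuous_fluct m h S) h4 fun v => norm_fluct_le m h v S
  have t0 := ae_tendsto_avg hindep hident continuous_id (l0.integrable (by norm_num))
  have t1 := ae_tendsto_avg hindep hident
    (g := fun v => InnerProductSpace.rankOne ℝ (v - m) (v - m))
    (continuous_rankOne_self.comp (by fun_prop)) (integrable_rankOne_self l1)
  have t2 := ae_tendsto_avg hindep hident (g := fun v => (1 + ‖v‖) ^ 4) (by fun_prop) h4
  have t3 := ae_tendsto_avg hindep hident
    (g := fun v => InnerProductSpace.rankOne ℝ (fluct m S h v) (fluct m S h v))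
    (continuous_rankOne_self.comp (continuous_fluct m h S)) (integrable_rankOne_self l2)
  simp only [id, ← hm] at t0
  rw [← hS] at t1
  filter_upwards [t0, t1, t2, t3] with ω a0 a1 a2 a3
  exact ⟨a0, tendsto_sampleRes hS0 hlam a0 a1, tendsto_sampleQ hS0 hlam a0 a1 hh a2 a3⟩

variable {n : ℕ} {φ : Fin n → H}

lemma ae_tendsto_sampleOmega (hlam : 0 < lam) (hindep : iIndepFun x Pr)
    (hident : ∀ i, IdentDistrib (x i) (x 0) Pr Pr)
    (h4 : Integrable (fun ω => (1 + ‖x 0 ω‖) ^ 4) Pr) (hm : m = ∫ ω, x 0 ω ∂Pr)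
    (hS : S = ∫ ω, InnerProductSpace.rankOne ℝ (x 0 ω - m) (x 0 ω - m) ∂Pr)
    {R Q : H →L[ℝ] H} (hR : R = Ring.inverse (S + lam • (1 : H →L[ℝ] H))) (hh : h = R m)
    (hQ : Q = ∫ ω, InnerProductSpace.rankOne ℝ (fluct m S h (x 0 ω)) (fluct m S h (x 0 ω)) ∂Pr) :
    ∀ᵐ ω ∂Pr, Tendsto (fun N => sampleOmega lam φ N fun i => x i ω) atTop
      (𝓝 (Matrix.of fun k j => inner ℝ (R (φ k)) (Q (R (φ j))))) := by
  subst hR hQ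
  filter_upwards [ae_tendsto_sample hlam hindep hident h4 hm hS hh] with ω ⟨_, h1, h2⟩
  refine tendsto_pi_nhds.2 fun k => tendsto_pi_nhds.2 fun j => ?_
  exact (tendsto_clm_apply h1 tendsto_const_nhds).inner
    (tendsto_clm_apply h2 (tendsto_clm_apply h1 tendsto_const_nhds))

/-- Asymptotic normality of the sample vector if the population vector vanishes. -/
lemma tendstoInDistribution_sampleTheta (hlam : 0 < lam) (hindep : iIndepFun x Pr)
    (hident : ∀ i, IdentDistrib (x i) (x 0) Pr Pr)
    (h4 : Integrable (fun ω => (1 + ‖x 0 ω‖) ^ 4) Pr) (hm : m = ∫ ω, x 0 ω ∂Pr)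
    (hS : S = ∫ ω, InnerProductSpace.rankOne ℝ (x 0 ω - m) (x 0 ω - m) ∂Pr)
    {R Q : H →L[ℝ] H} (hR : R = Ring.inverse (S + lam • (1 : H →L[ℝ] H))) (hh : h = R m)
    (hQ : Q = ∫ ω, InnerProductSpace.rankOne ℝ (fluct m S h (x 0 ω)) (fluct m S h (x 0 ω)) ∂Pr)
    (hφ : ∀ j, inner ℝ (φ j) h = 0)
    (hpos : (Matrix.of fun k j => inner ℝ (R (φ k)) (Q (R (φ j)))).PosSemidef) :
    TendstoInDistribution (fun (N : ℕ) ω => √N • sampleTheta lam φ N fun i => x i ω) atTop id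
      (fun _ => Pr)
      (multivariateGaussian 0 (Matrix.of fun k j => inner ℝ (R (φ k)) (Q (R (φ j))))) := by
  have hxm (i : ℕ) : AEMeasurable (x i) Pr := (hident i).aemeasurable_fst
  have hxpi : AEMeasurable (fun ω i => x i ω) Pr := aemeasurable_pi_lambda _ hxm
  have hS0 : ∀ u, 0 ≤ inner ℝ (S u) u := by
    rw [hS]
    exact inner_integral_rankOne_self_nonneg _ _
  have hhm : S h + lam • h = m := by
    have := add_smul_one_apply_inverse hS0 hlam m
    rw [← hR, ← hh] at this
    simpa using this
  set u : Fin n → H := fun j => R (φ j) with hu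
  set f : H → H := fluct m S h with hf
  have hfc : Continuous f := continuous_fluct m h S
  have l0 : MemLp (x 0) 2 Pr :=
    memLp_two_of_norm_le (f := id) (hxm 0) continuous_id h4 (c := 1)
      fun v => by simpa using norm_sub_le_mul_sq 0 v
  have l1 : MemLp (fun ω => x 0 ω - m) 2 Pr := l0.sub (memLp_const m)
  have l2 : MemLp (fun ω => f (x 0 ω)) 2 Pr :=
    memLp_two_of_norm_le (hxm 0) hfc h4 fun v => norm_fluct_le m h v S
  have m1 : ∫ ω, (x 0 ω - m) ∂Pr = 0 := by
    rw [integral_sub (l0.integrable (by norm_num)) (integrable_const m), integral_const, ← hm]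
    simp
  have m2 : ∫ ω, f (x 0 ω) ∂Pr = 0 := integral_fluct_eq_zero l0 hm hS h
  have hVc : Continuous fun v => innerVec u (f v) := (innerVec u).continuous.comp hfc
  -- The linear part of the expansion: the coordinates `⟪u_j, F⟫` have covariances `⟪u_k, Q u_j⟫`.
  have hclt := tendstoInDistribution_inv_sqrt_smul_sum (Pr := Pr)
    (V := fun i ω => innerVec u (f (x i ω))) hpos
    (hindep.comp (fun _ v => innerVec u (f v)) fun _ => hVc.measurable)
    (fun i => (hident i).comp hVc.measurable) ((innerVec u).comp_memLp' l2)
    (by rw [(innerVec u).integral_comp_comm (l2.integrable (by norm_num)), m2, map_zero])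
    (fun t => by
      simp_rw [inner_innerVec, sq]
      rw [← inner_integral_rankOne_self l2, ← hQ, real_inner_comm, sum_inner]
      simp only [dotProduct, Matrix.mulVec, Matrix.of_apply, map_sum, map_smul,
        inner_sum, inner_smul_left, inner_smul_right, RCLike.conj_to_real]
      refine Finset.sum_congr rfl fun k _ => ?_
      rw [Finset.mul_sum]
      refine Finset.sum_congr rfl fun j _ => ?_
      rw [hu]
      ring)
  -- For `N = 0` both sides are zero.
  have e (N : ℕ) (ω : Ω) : (√N)⁻¹ • ∑ i ∈ Finset.range N, innerVec u (f (x i ω)) =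
      √N • innerVec u (avg N fun i => f (x i ω)) := by
    rw [map_avg, avg, smul_smul]
    congr 1
    rcases eq_or_ne N 0 with rfl | hN
    · simp
    · have : (0 : ℝ) < N := by exact_mod_cast Nat.pos_of_ne_zero hN
      have hs : √(N : ℝ) ≠ 0 := by positivity
      field_simp
      rw [Real.sq_sqrt this.le]
  simp_rw [e] at hclt
  obtain ⟨i1, b1⟩ : (∀ N : ℕ, Integrable (fun ω => ‖√N • avg N fun i => f (x i ω)‖ ^ 2) Pr) ∧
      ∀ N : ℕ, ∫ ω, ‖√N • avg N fun i => f (x i ω)‖ ^ 2 ∂Pr ≤ ∫ ω, ‖f (x 0 ω)‖ ^ 2 ∂Pr :=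
    forall_and.1 fun N => integral_norm_sqrt_smul_avg_sq (V := fun i ω => f (x i ω))
      (fun i j hij => (hindep.indepFun hij).comp hfc.measurable hfc.measurable)
      (fun i => (hident i).comp hfc.measurable) l2 m2 N
  have hgc : Continuous fun v : H => v - m := by fun_prop
  obtain ⟨i2, b2⟩ : (∀ N : ℕ, Integrable (fun ω => ‖√N • avg N fun i => x i ω - m‖ ^ 2) Pr) ∧
      ∀ N : ℕ, ∫ ω, ‖√N • avg N fun i => x i ω - m‖ ^ 2 ∂Pr ≤ ∫ ω, ‖x 0 ω - m‖ ^ 2 ∂Pr :=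
    forall_and.1 fun N => integral_norm_sqrt_smul_avg_sq (V := fun i ω => x i ω - m)
      (fun i j hij => (hindep.indepFun hij).comp hgc.measurable hgc.measurable)
      (fun i => (hident i).comp hgc.measurable) l1 m1 N
  have hθm (N : ℕ) : AEMeasurable (fun ω => √N • sampleTheta lam φ N fun i => x i ω) Pr :=
    ((continuous_sampleTheta hlam N).measurable.comp_aemeasurable hxpi).fun_const_smul _
  -- It remains to show that the linearization error tends to zero in measure. `A` and `B` below are
  -- bounded in `L²`, and `a` tends to zero almost surely.
  refine tendstoInDistribution_of_tendstoInMeasure_sub _ _ hclt ?_ hθm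
  let A : ℕ → Ω → H := fun N ω => √N • avg N fun i => f (x i ω)
  let B : ℕ → Ω → H := fun N ω => √N • avg N fun i => x i ω - m
  let a : ℕ → (ℕ → H) → ℝ := fun N y => ∑ j, (‖sampleRes lam N y (φ j) - u j‖ +
    ‖h‖ * ‖avg N y - m‖ * ‖sampleRes lam N y (φ j)‖)
  have ha (N : ℕ) : Continuous (a N) := by
    have c1 := continuous_sampleRes (H := H) hlam N
    have c2 : Continuous fun y : ℕ → H => avg N y := continuous_avg fun i => continuous_apply i
    fun_prop
  have hAm (N : ℕ) : AEMeasurable (fun ω => A N ω) Pr := by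
    have c : Continuous fun y : ℕ → H => √N • avg N fun i => f (y i) :=
      (continuous_avg fun i => hfc.comp (continuous_apply i)).const_smul _
    exact c.measurable.comp_aemeasurable hxpi
  have hBm (N : ℕ) : AEMeasurable (fun ω => B N ω) Pr := by
    have c : Continuous fun y : ℕ → H => √N • avg N fun i => y i - m :=
      (continuous_avg fun i => hgc.comp (continuous_apply i)).const_smul _
    exact c.measurable.comp_aemeasurable hxpi
  have hle (N : ℕ) (ω : Ω) : (‖A N ω‖ + ‖B N ω‖) ^ 2 ≤ 2 * ‖A N ω‖ ^ 2 + 2 * ‖B N ω‖ ^ 2 := by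
    nlinarith [sq_nonneg (‖A N ω‖ - ‖B N ω‖)]
  have hdom (N : ℕ) : Integrable (fun ω => 2 * ‖A N ω‖ ^ 2 + 2 * ‖B N ω‖ ^ 2) Pr :=
    ((i1 N).const_mul 2).add ((i2 N).const_mul 2)
  have hXint (N : ℕ) : Integrable (fun ω => (‖A N ω‖ + ‖B N ω‖) ^ 2) Pr := by
    refine (hdom N).mono (((hAm N).norm.add (hBm N).norm).pow_const 2).aestronglyMeasurable
      (ae_of_all _ fun ω => ?_)
    rw [Real.norm_of_nonneg (by positivity), Real.norm_of_nonneg (by positivity)]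
    exact hle N ω
  refine tendstoInMeasure_zero_of_norm_le_mul (X := fun N ω => ‖A N ω‖ + ‖B N ω‖)
    (a := fun N ω => a N fun i => x i ω)
    (C := 2 * ∫ ω, ‖f (x 0 ω)‖ ^ 2 ∂Pr + 2 * ∫ ω, ‖x 0 ω - m‖ ^ 2 ∂Pr) hXint (fun N => ?_)
    (fun N => ((ha N).measurable.comp_aemeasurable hxpi).aestronglyMeasurable) ?_ ?_
  · refine (integral_mono (hXint N) (hdom N) (hle N)).trans ?_
    rw [integral_add ((i1 N).const_mul 2) ((i2 N).const_mul 2), integral_const_mul,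
      integral_const_mul]
    exact add_le_add (mul_le_mul_of_nonneg_left (b1 N) (by norm_num))
      (mul_le_mul_of_nonneg_left (b2 N) (by norm_num))
  · filter_upwards [ae_tendsto_sample hlam hindep hident h4 hm hS (hh.trans (by rw [hR]))] with ω
      ⟨h1, h2, _⟩
    rw [← hR] at h2
    have t (j : Fin n) : Tendsto (fun N => sampleRes lam N (fun i => x i ω) (φ j)) atTop
        (𝓝 (u j)) := tendsto_clm_apply h2 tendsto_const_nhds
    have t1 (j : Fin n) := ((t j).sub_const (u j)).norm.add
      ((((h1.sub_const m).norm).const_mul ‖h‖).mul (t j).norm)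
    simpa using tendsto_finsetSum Finset.univ fun j _ => t1 j
  · filter_upwards [eventually_ne_atTop 0] with N hN ω
    refine (norm_sqrt_smul_sampleTheta_sub_le hlam hN (fun i => x i ω) hhm hφ u).trans ?_
    exact mul_le_mul (le_abs_self _) (le_abs_self _) (by positivity) (abs_nonneg _)

end Asymptotics

/-! ### From asymptotic normality to the limit of the test statistic. -/

section Slutsky

variable {Ω : Type*} [MeasurableSpace Ω] {Pr : Measure Ω} [IsProbabilityMeasure Pr] {n : ℕ}
  {θ : ℕ → Ω → EuclideanSpace ℝ (Fin n)} {A : ℕ → Ω → Matrix (Fin n) (Fin n) ℝ}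
  {V : Matrix (Fin n) (Fin n) ℝ}

lemma testStat_zero (v : EuclideanSpace ℝ (Fin n)) (B : Matrix (Fin n) (Fin n) ℝ) :
    testStat 0 v B = 0 := by
  simp [testStat]

lemma orthantDist_zero {B : Matrix (Fin n) (Fin n) ℝ} (hB : B.PosSemidef) :
    orthantDist B 0 = 0 :=
  le_antisymm ((orthantDist_le_quad hB 0).trans (by simp [quad]))
    (Real.iInf_nonneg fun _ => quad_nonneg hB _)

lemma tendsto_matrix_inv {ι : Type*} {l : Filter ι} {B : ι → Matrix (Fin n) (Fin n) ℝ}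
    (hB : Tendsto B l (𝓝 V)) (hV : V.det ≠ 0) : Tendsto (fun i => (B i)⁻¹) l (𝓝 V⁻¹) := by
  have h1 : Tendsto (fun i => (B i).det) l (𝓝 V.det) :=
    ((continuous_id.matrix_det).tendsto V).comp hB
  have h2 : Tendsto (fun i => (B i).adjugate) l (𝓝 V.adjugate) :=
    ((continuous_id.matrix_adjugate).tendsto V).comp hB
  simp only [Matrix.inv_def, Ring.inverse_eq_inv']
  exact (h1.inv₀ hV).smul h2

/-- Slutsky's theorem for the test statistic. -/
lemma tendstoInDistribution_testStat (hV : V.PosDef) (hA : ∀ N ω, (A N ω).PosSemidef)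
    (hθ : TendstoInDistribution (fun (N : ℕ) ω => √N • θ N ω) atTop id (fun _ => Pr)
      (multivariateGaussian 0 V))
    (hAV : ∀ᵐ ω ∂Pr, Tendsto (fun N => A N ω) atTop (𝓝 V))
    (hm : ∀ N, AEMeasurable (fun ω => testStat N (θ N ω) (A N ω)) Pr) :
    TendstoInDistribution (fun N ω => testStat N (θ N ω) (A N ω)) atTop (orthantDist V⁻¹)
      (fun _ => Pr) (multivariateGaussian 0 V) := by
  obtain ⟨C, hC, hquad⟩ := exists_abs_quad_sub_le hV.inv
  let ε : ℕ → Ω → ℝ := fun N ω => C * ∑ i, ∑ j, |(A N ω)⁻¹ i j - V⁻¹ i j|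
  have hε (N : ℕ) (ω : Ω) : 0 ≤ ε N ω := by positivity
  let T : ℕ → Ω → EuclideanSpace ℝ (Fin n) := fun N ω => √N • θ N ω
  have hbound (N : ℕ) (ω : Ω) : |testStat N (θ N ω) (A N ω) - orthantDist V⁻¹ (T N ω)| ≤
      ε N ω * quad V⁻¹ (T N ω) := by
    rcases eq_or_ne N 0 with rfl | hN
    · have : T 0 ω = 0 := by simp [T]
      rw [this, testStat_zero, orthantDist_zero hV.inv.posSemidef]
      simp [quad]
    · rw [testStat_eq hN]
      refine (abs_orthantDist_sub_le (hA N ω).inv hV.inv (hquad _) _).trans ?_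
      exact mul_le_mul_of_nonneg_left (orthantDist_le_quad hV.inv.posSemidef _) (hε N ω)
  -- The relative error of replacing the estimated form by `V⁻¹`. It tends to zero almost surely,
  -- and the statistic is a continuous function of the pair `(T, κ)`, so Slutsky's theorem for pairs
  -- applies.
  let κ : ℕ → Ω → ℝ := fun N ω =>
    (testStat N (θ N ω) (A N ω) - orthantDist V⁻¹ (T N ω)) / quad V⁻¹ (T N ω)
  have hκm (N : ℕ) : AEMeasurable (κ N) Pr := by
    have hT := hθ.forall_aemeasurable N
    exact ((hm N).sub ((continuous_orthantDist hV.inv).measurable.comp_aemeasurable hT)).div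
      ((continuous_quad _).measurable.comp_aemeasurable hT)
  have hκ : ∀ᵐ ω ∂Pr, Tendsto (fun N => κ N ω) atTop (𝓝 0) := by
    filter_upwards [hAV] with ω hω
    refine squeeze_zero_norm (a := fun N => ε N ω) (fun N => ?_) ?_
    · have hq := quad_nonneg hV.inv.posSemidef (T N ω)
      rw [Real.norm_eq_abs, abs_div, abs_of_nonneg hq]
      exact div_le_of_le_mul₀ hq (hε N ω) (hbound N ω)
    · have h1 := tendsto_matrix_inv hω hV.det_pos.ne'
      have h2 (i j : Fin n) : Tendsto (fun N => |(A N ω)⁻¹ i j - V⁻¹ i j|) atTop (𝓝 0) := by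
        simpa using ((tendsto_pi_nhds.1 (tendsto_pi_nhds.1 h1 i) j).sub_const (V⁻¹ i j)).abs
      simpa using (tendsto_finsetSum Finset.univ fun i _ =>
        tendsto_finsetSum Finset.univ fun j _ => h2 i j).const_mul C
  have hfun : (fun N ω => testStat N (θ N ω) (A N ω)) = fun N ω =>
      orthantDist V⁻¹ (T N ω) + κ N ω * quad V⁻¹ (T N ω) := by
    ext N ω
    have hb := hbound N ω
    -- When the form vanishes, division by zero sets `κ` to zero, but then the bound forces the two
    -- statistics to agree.
    by_cases hq : quad V⁻¹ (T N ω) = 0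
    · rw [hq, mul_zero, abs_nonpos_iff, sub_eq_zero] at hb
      rw [hq, mul_zero, add_zero, hb]
    · rw [div_mul_cancel₀ _ hq]
      ring
  have hg : Continuous fun p : EuclideanSpace ℝ (Fin n) × ℝ =>
      orthantDist V⁻¹ p.1 + p.2 * quad V⁻¹ p.1 :=
    ((continuous_orthantDist hV.inv).comp continuous_fst).add
      (continuous_snd.mul ((continuous_quad _).comp continuous_fst))
  have := hθ.continuous_comp_prodMk_of_tendstoInMeasure_const hg
    (tendstoInMeasure_of_tendsto_ae (fun N => (hκm N).aestronglyMeasurable) hκ) hκm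
  rw [hfun]
  simpa using this

/-- Moreau's decomposition shows that the limit variable `orthantDist V⁻¹` has the chi-bar-squared
law of the polar cone. -/
lemma tendstoInDistribution_testStat_chiBarSq (hV : V.PosDef) (hA : ∀ N ω, (A N ω).PosSemidef)
    (hθ : TendstoInDistribution (fun (N : ℕ) ω => √N • θ N ω) atTop id (fun _ => Pr)
      (multivariateGaussian 0 V))
    (hAV : ∀ᵐ ω ∂Pr, Tendsto (fun N => A N ω) atTop (𝓝 V))
    (hm : ∀ N, AEMeasurable (fun ω => testStat N (θ N ω) (A N ω)) Pr)
    [IsProbabilityMeasure (chiBarSq V (polarCone V (orthant n)))] :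
    TendstoInDistribution (fun N ω => testStat N (θ N ω) (A N ω)) atTop id
      (fun _ => Pr) (chiBarSq V (polarCone V (orthant n))) := by
  have h := tendstoInDistribution_testStat hV hA hθ hAV hm
  refine ⟨hm, aemeasurable_id, ?_⟩
  refine h.tendsto.trans_eq (congrArg 𝓝 (Subtype.ext ?_))
  change (multivariateGaussian 0 V).map (orthantDist V⁻¹) = (chiBarSq V _).map id
  rw [Measure.map_id, chiBarSq, funext (chiBarStat_polarCone hV)]

end Slutsky

/-! ### Empirical measures turn the population formulas into sample statistics. -/

section Empirical

variable {d : ℕ} {X : Set (EuclideanSpace ℝ (Fin d))} {Y : Set ℝ}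
  {H : Type*} [NormedAddCommGroup H] [InnerProductSpace ℝ H] [CompleteSpace H] [RKHS ℝ H X ℝ]
  {s : ℕ} {w : (Fin d → ℕ) → X × Y → ℝ} {lam : ℝ}

lemma meanVec_empirical (N : ℕ) (z : ℕ → X × Y) :
    meanVec H s w (empirical N z) = avg N fun i => psi H s w (z i) :=
  integral_empirical N z _

lemma covOp_empirical (N : ℕ) (z : ℕ → X × Y) :
    covOp H s w (empirical N z) = sampleCov N fun i => psi H s w (z i) := by
  rw [covOp, integral_empirical, meanVec_empirical]
  rfl

lemma resolventOp_empirical (N : ℕ) (z : ℕ → X × Y) :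
    resolventOp H s w lam (empirical N z) = sampleRes lam N fun i => psi H s w (z i) := by
  rw [resolventOp, covOp_empirical]
  rfl

lemma minimizer_empirical (hK : KernelIsCk H (2 * s)) (hX : X ⊆ closure (interior X))
    (hlam : 0 < lam) {N : ℕ} (hN : N ≠ 0) (z : ℕ → X × Y) :
    minimizer H s w lam (empirical N z) = sampleMin lam N fun i => psi H s w (z i) := by
  have := isProbabilityMeasure_empirical hN z
  rw [minimizer_eq hK hX hlam, meanVec_empirical, resolventOp_empirical]
  · rfl
  · rw [memLp_two_iff_integrable_sq_norm (integrable_empirical hN z _).1]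
    exact integrable_empirical hN z _

lemma theta_empirical (hK : KernelIsCk H (2 * s)) (hX : X ⊆ closure (interior X))
    (hlam : 0 < lam) {α : Fin d → ℕ} (hα : α ∈ multiIndices d s) {n : ℕ} (ξ : Fin n → X) {N : ℕ}
    (hN : N ≠ 0) (z : ℕ → X × Y) :
    theta H s w lam α ξ (empirical N z) =
      sampleTheta lam (fun j => featureDeriv H α (ξ j)) N fun i => psi H s w (z i) := by
  ext j
  simp only [theta, sampleTheta]
  rw [hK.pderivOn_eq_inner hX hα, minimizer_empirical hK hX hlam hN]

lemma Omega_empirical (hK : KernelIsCk H (2 * s)) (hX : X ⊆ closure (interior X))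
    (hlam : 0 < lam) (α : Fin d → ℕ) {n : ℕ} (ξ : Fin n → X) {N : ℕ} (hN : N ≠ 0)
    (z : ℕ → X × Y) :
    Omega H s w lam α ξ (empirical N z) =
      sampleOmega lam (fun j => featureDeriv H α (ξ j)) N fun i => psi H s w (z i) := by
  have hF : fluctuationCov H s w lam (empirical N z) =
      sampleQ lam N fun i => psi H s w (z i) := by
    rw [fluctuationCov, integral_empirical]
    simp only [fluctuation, minimizer_empirical hK hX hlam hN, covOp_empirical, meanVec_empirical]
    rfl
  rw [Omega, hF, resolventOp_empirical]
  rfl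

/-- Outside the trivial case `N = 0` the arguments are the sample quantities of the features. -/
lemma testStat_empirical (hK : KernelIsCk H (2 * s)) (hX : X ⊆ closure (interior X))
    (hlam : 0 < lam) {α : Fin d → ℕ} (hα : α ∈ multiIndices d s) {n : ℕ} (ξ : Fin n → X) (N : ℕ)
    (z : ℕ → X × Y) :
    testStat N (theta H s w lam α ξ (empirical N z)) (Omega H s w lam α ξ (empirical N z)) =
      testStat N (sampleTheta lam (fun j => featureDeriv H α (ξ j)) N fun i => psi H s w (z i))
        (sampleOmega lam (fun j => featureDeriv H α (ξ j)) N fun i => psi H s w (z i)) := by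
  rcases eq_or_ne N 0 with rfl | hN
  · rw [testStat_zero, testStat_zero]
  · rw [theta_empirical hK hX hlam hα ξ hN, Omega_empirical hK hX hlam α ξ hN]

end Empirical

section Moments

/-- Convexity of the fourth power at the midpoint of 1 and `a`; the constant is `2 ^ 3`. -/
lemma one_add_pow_four_le (a : ℝ) : (1 + a) ^ 4 ≤ 8 * (1 + a ^ 4) := by
  nlinarith [sq_nonneg (a - 1), sq_nonneg (a ^ 2 - 1), sq_nonneg (a + 1), sq_nonneg (a * (a - 1))]

end Moments

/-! ### Assembly of the limit theorem for the original data. -/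

section Population

variable {d : ℕ} {X : Set (EuclideanSpace ℝ (Fin d))} {Y : Set ℝ}
  {H : Type*} [NormedAddCommGroup H] [InnerProductSpace ℝ H] [CompleteSpace H] [RKHS ℝ H X ℝ]
  {s : ℕ} {w : (Fin d → ℕ) → X × Y → ℝ} {lam : ℝ} {P : Measure (X × Y)} [IsProbabilityMeasure P]
  {Ω : Type*} [MeasurableSpace Ω] {Pr : Measure Ω} [IsProbabilityMeasure Pr] {z : ℕ → Ω → X × Y}

/-- The limit law of the test statistic. -/
theorem tendstoInDistribution_testStat_empirical [MeasurableSpace H] [BorelSpace H]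
    (hX : X ⊆ closure (interior X)) (hK : KernelIsCk H (2 * s))
    (hw : ∀ β ∈ multiIndices d s, Measurable (w β)) (hlam : 0 < lam)
    (hmom : Integrable (fun z => ‖psi H s w z‖ ^ 4) P) (hz : ∀ i, HasLaw (z i) P Pr)
    (hindep : iIndepFun (fun i ω => psi H s w (z i ω)) Pr)
    {α : Fin d → ℕ} (hα : α ∈ multiIndices d s) {n : ℕ} {ξ : Fin n → X}
    (hpos : (Omega H s w lam α ξ P).PosDef) (hnull : theta H s w lam α ξ P = 0)
    [IsProbabilityMeasure (chiBarSq (Omega H s w lam α ξ P)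
      (polarCone (Omega H s w lam α ξ P) (orthant n)))] :
    TendstoInDistribution (fun N ω => testStat N
        (theta H s w lam α ξ (empirical N fun i => z i ω))
        (Omega H s w lam α ξ (empirical N fun i => z i ω))) atTop id (fun _ => Pr)
      (chiBarSq (Omega H s w lam α ξ P)
        (polarCone (Omega H s w lam α ξ P) (orthant n))) := by
  have := hK.secondCountableTopology
  have hψ : StronglyMeasurable (psi H s w) := stronglyMeasurable_psi hK hX hw
  let x : ℕ → Ω → H := fun i ω => psi H s w (z i ω)
  let φ : Fin n → H := fun j => featureDeriv H α (ξ j)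
  -- Population integrals are carried over to the probability space of the sample, where the limit
  -- theorems are stated for `x i = ψ(z i)`.
  have hlaw {F : Type _} [NormedAddCommGroup F] [NormedSpace ℝ F] {g : X × Y → F}
      (hg : StronglyMeasurable g) : ∫ a, g a ∂P = ∫ ω, g (z 0 ω) ∂Pr :=
    ((hz 0).integral_comp hg.aestronglyMeasurable).symm
  have hident (i : ℕ) : IdentDistrib (x i) (x 0) Pr Pr :=
    IdentDistrib.comp (f := z i) (g := z 0)
      ⟨(hz i).aemeasurable, (hz 0).aemeasurable, (hz i).map_eq.trans (hz 0).map_eq.symm⟩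
      hψ.measurable
  have hx4 : Integrable (fun ω => ‖x 0 ω‖ ^ 4) Pr := by
    rw [← (hz 0).map_eq] at hmom
    exact hmom.comp_aemeasurable (hz 0).aemeasurable
  have h4 : Integrable (fun ω => (1 + ‖x 0 ω‖) ^ 4) Pr := by
    refine (((integrable_const 1).add hx4).const_mul 8).mono
      (((hident 0).aemeasurable_fst.norm.const_add 1).pow_const 4).aestronglyMeasurable
      (ae_of_all _ fun ω => ?_)
    rw [Real.norm_of_nonneg (by positivity), Real.norm_of_nonneg
      (by simp only [Pi.add_apply]; positivity)]
    exact one_add_pow_four_le _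
  have l0 : MemLp (psi H s w) 2 P := by
    have h := memLp_two_of_norm_le (f := id) (hident 0).aemeasurable_fst continuous_id h4 (c := 1)
      fun v => by simpa using norm_sub_le_mul_sq 0 v
    rw [← (hz 0).map_eq]
    exact (memLp_map_measure_iff hψ.aestronglyMeasurable (hz 0).aemeasurable).2 h
  have hmin := minimizer_eq hK hX hlam l0
  have hm : meanVec H s w P = ∫ ω, x 0 ω ∂Pr := hlaw hψ
  have hS : covOp H s w P = ∫ ω, InnerProductSpace.rankOne ℝ (x 0 ω - meanVec H s w P)
      (x 0 ω - meanVec H s w P) ∂Pr :=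
    hlaw (continuous_rankOne_self.comp_stronglyMeasurable (hψ.sub stronglyMeasurable_const))
  have hQ : fluctuationCov H s w lam P = ∫ ω, InnerProductSpace.rankOne ℝ
      (fluct (meanVec H s w P) (covOp H s w P) (minimizer H s w lam P) (x 0 ω))
      (fluct (meanVec H s w P) (covOp H s w P) (minimizer H s w lam P) (x 0 ω)) ∂Pr :=
    hlaw (continuous_rankOne_self.comp_stronglyMeasurable
      ((continuous_fluct _ _ _).comp_stronglyMeasurable hψ))
  -- The only use of the null hypothesis: the minimizer is orthogonal to every `φ_j`.
  have hφ (j : Fin n) : inner ℝ (φ j) (minimizer H s w lam P) = 0 := by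
    rw [← hK.pderivOn_eq_inner hX hα]
    exact congrArg (fun v : EuclideanSpace ℝ (Fin n) => v j) hnull
  have hθ := tendstoInDistribution_sampleTheta (φ := φ) hlam hindep hident h4 hm hS rfl hmin hQ hφ
    hpos.posSemidef
  have hΩ := ae_tendsto_sampleOmega (φ := φ) hlam hindep hident h4 hm hS rfl hmin hQ
  simp_rw [testStat_empirical hK hX hlam hα ξ]
  refine tendstoInDistribution_testStat_chiBarSq hpos (fun N ω => posSemidef_sampleOmega N _) hθ hΩ
    fun N => ?_
  exact (measurable_testStat N (continuous_sampleTheta (φ := φ) hlam N)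
    (continuous_sampleOmega (φ := φ) hlam N) (posSemidef_sampleOmega N)).comp_aemeasurable
    (aemeasurable_pi_lambda _ fun i => (hident i).aemeasurable_fst)

end Population

end KernelShapeTest

end

open KernelShapeTest in
theorem mainTheorem1
    {d : ℕ} (X : Set (EuclideanSpace ℝ (Fin d))) (hX : X ⊆ closure (interior X)) (Y : Set ℝ)
    (H : Type*) [NormedAddCommGroup H] [InnerProductSpace ℝ H] [CompleteSpace H] [RKHS ℝ H X ℝ]
    [MeasurableSpace H] [BorelSpace H]
    (s : ℕ) (hK : KernelIsCk H (2 * s))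
    (w : (Fin d → ℕ) → X × Y → ℝ) (hw : ∀ β ∈ multiIndices d s, Measurable (w β))
    (lam : ℝ) (hlam : 0 < lam)
    (P : Measure (X × Y)) [IsProbabilityMeasure P]
    (hmom : Integrable (fun z => ‖psi H s w z‖ ^ 4) P)
    {Ω : Type*} [MeasurableSpace Ω] (Pr : Measure Ω) [IsProbabilityMeasure Pr]
    (z : ℕ → Ω → X × Y) (hz : ∀ i, HasLaw (z i) P Pr)
    (hindep : iIndepFun (fun i ω => psi H s w (z i ω)) Pr)
    (α : Fin d → ℕ) (hα : α ∈ multiIndices d s) {n : ℕ} (ξ : Fin n → X)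
    (hpos : (Omega H s w lam α ξ P).PosDef)
    (hnull : theta H s w lam α ξ P = 0)
    (W : ℕ → Ω → ℝ)
    (hW : W = fun N ω => testStat N
      (theta H s w lam α ξ (empirical N fun i => z i ω))
      (Omega H s w lam α ξ (empirical N fun i => z i ω))) :
    -- the infimum that defines the test statistic is a minimum
    (∀ (N : ℕ) (ω : Ω), IsLeast ((fun c => (N : ℝ) * quad (Omega H s w lam α ξ (empirical N fun i => z i ω))⁻¹
        (theta H s w lam α ξ (empirical N fun i => z i ω) - c)) '' orthant n) (W N ω)) ∧
    -- convergence in distribution to the chi-bar-squared law of the polar cone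
    (∃ _ : IsProbabilityMeasure (chiBarSq (Omega H s w lam α ξ P)
          (polarCone (Omega H s w lam α ξ P) (orthant n))),
      TendstoInDistribution W atTop (id : ℝ → ℝ) (fun _ => Pr)
        (chiBarSq (Omega H s w lam α ξ P)
          (polarCone (Omega H s w lam α ξ P) (orthant n)))) ∧
    -- almost sure decomposition, for the chi-bar-squared variables built from a common Gaussian `G`
    (∀ {Ω' : Type*} [MeasurableSpace Ω'] (Pr' : Measure Ω') [IsProbabilityMeasure Pr']
      (G : Ω' → EuclideanSpace ℝ (Fin n)),
      HasLaw G (multivariateGaussian 0 (Omega H s w lam α ξ P)) Pr' →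
      HasLaw (fun ω => chiBarStat (Omega H s w lam α ξ P)
          (polarCone (Omega H s w lam α ξ P) (orthant n)) (G ω))
        (chiBarSq (Omega H s w lam α ξ P)
          (polarCone (Omega H s w lam α ξ P) (orthant n))) Pr' ∧
      HasLaw (fun ω => chiBarStat (Omega H s w lam α ξ P) (orthant n) (G ω))
        (chiBarSq (Omega H s w lam α ξ P) (orthant n)) Pr' ∧
      HasLaw (fun ω => quad (Omega H s w lam α ξ P)⁻¹ (G ω)) (chiSq n) Pr' ∧
      ∀ᵐ ω ∂Pr', chiBarStat (Omega H s w lam α ξ P)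
          (polarCone (Omega H s w lam α ξ P) (orthant n)) (G ω) =
        quad (Omega H s w lam α ξ P)⁻¹ (G ω) -
          chiBarStat (Omega H s w lam α ξ P) (orthant n) (G ω)) := by
  refine ⟨fun N ω => ?_, ?_, fun Pr' _ G hG => ?_⟩
  · rw [hW]
    exact isLeast_testStat N _ (posSemidef_Omega _ α ξ)
  · have hprob : IsProbabilityMeasure (chiBarSq (Omega H s w lam α ξ P)
        (polarCone (Omega H s w lam α ξ P) (orthant n))) :=
      Measure.isProbabilityMeasure_map (measurable_chiBarStat_polarCone hpos).aemeasurable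
    refine ⟨hprob, ?_⟩
    rw [hW]
    exact tendstoInDistribution_testStat_empirical hX hK hw hlam hmom hz hindep hα hpos hnull
  · have h1 := measurable_chiBarStat_polarCone hpos
    have h2 := measurable_chiBarStat_orthant hpos
    refine ⟨HasLaw.comp (Y := chiBarStat _ _) ⟨h1.aemeasurable, rfl⟩ hG,
      HasLaw.comp (Y := chiBarStat _ _) ⟨h2.aemeasurable, rfl⟩ hG, (hasLaw_quad_inv hpos).comp hG,
      ae_of_all _ fun ω => ?_⟩
    -- The identity holds at every point: the left side is the squared distance to the orthant,
    -- which is also what the statistic of the orthant subtracts from the full form.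
    rw [chiBarStat_polarCone hpos, chiBarStat_orthant]
    ring
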